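/- Let $n\ge 2$, $0\le k\le m$, and let $f\in\mathcal E'(\mathbb R^n;S^m)$ be a compactly supported (complex-valued) symmetric $m$-tensor field distribution on $\mathbb R^n$. Repeated indices are summed from $1$ to $n$, $\sigma(i_1\dots i_a)$ denotes symmetrization in $i_1,\dots,i_a$ (average over all permutations), and $\alpha(p\,q)$ denotes alternation, $\alpha(p\,q)u_{pq}=\tfrac12(u_{pq}-u_{qp})$. Notation. * For a tensor field $u$ of rank $s$, $$(Ru)_{p_1q_1\dots p_sq_s}=\alpha(p_1q_1)\cdots\alpha(p_sq_s)\,\frac{\partial^s u_{p_1\dots p_s}}{\partial x_{q_1}\cdots\partial x_{q_s}} .$$ For a symmetric tensor field $u$ of rank $s+t$ and fixed indices $i_1,\dots,i_t$, $u^{i_1\dots i_t}$ is the rank $s$ field $(u^{i_1\dots i_t})_{p_1\dots p_s}=u_{p_1\dots p_si_1\dots i_t}$, and $$(R^{t}u)_{p_1q_1\dots p_sq_s\,i_1\dots i_t}=(R(u^{i_1\dots i_t}))_{p_1q_1\dots p_sq_s}.$$ * $(\delta u)_{i_1\dots i_{a}}=\partial u_{i_1\dots i_{a}i_{a+1}}/\partial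 x_{i_{a+1}}$ is the divergence, $(j_{x^{\odot b}}u)_{i_1\dots i_a}=x_{p_1}\cdots x_{p_b}\,u_{i_1\dots i_ap_1\dots p_b}$, $(ju)_{i_1\dots i_a}=u_{i_1\dots i_a\,b\,b}$ is contraction with the Euclidean metric and $(iu)_{i_1\dots i_{a+2}}=\sigma(i_1\dots i_{a+2})\,\delta_{i_1i_2}u_{i_3\dots i_{a+2}}$ is symmetric multiplication by it. * $N_m^p=(I_m^p)^*I_m^p$ is the normal operator of the $p$-th momentum ray transform $I_m^pf(x,\xi)=\int_{\mathbb R}t^p f_{i_1\dots i_m}(x+t\xi)\xi_{i_1}\cdots\xi_{i_m}\,dt$ $(|\xi|=1,\ x\perp\xi)$, which is defined on $\mathcal E'(\mathbb R^n;S^m)$, with values in $\mathcal D'(\mathbb R^n;S^m)$, by $$(N_m^pf)_{i_1\dots i_m}=2\sum_{l=0}^p\binom pl(-1)^l\,x_{a_1}\cdots x_{a_{2p-l}}\left[f_{j_1\dots j_m}*\frac{x_{a_1}\cdots x_{a_{2p-l}}\,x_{i_1}\cdots x_{i_m}\,x_{j_1}\cdots x_{j_m}}{|x|^{2m+2p-2l+n-1}}\right].$$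 $N_0=N_0^0$ is the normal operator of the ray transform of scalar functions, $N_0h=2\,h*|x|^{1-n}$. * $\displaystyle c_{l,s}=\Big\{\prod_{w=0}^{s-l-1}(n-1+2w)\Big\}\frac{(-1)^l\,s!}{2^l\,l!\,(s-2l)!}$ for $0\le l\le\lfloor s/2\rfloor$. * For $0\le r\le k$, $G_{m-r}$ is the $(m-r)$-tensor field distribution $$G_{m-r}=\sum_{l=0}^{\lfloor\frac{m-r}2\rfloor}c_{l,m-r}\;i^l j^l\Big(\sum_{p=0}^r(-1)^{r-p}\frac1{p!}\binom rp\,j_{x^{\odot(r-p)}}\,\delta^pN_m^pf\Big).$$ Then each $G_{m-r}$ is indeed symmetric, and for all indices $p_1,\dots,p_{m-k},q_1,\dots,q_{m-k},i_1,\dots,i_k\in\{1,\dots,n\}$, the following equality holds in $\mathcal D'(\mathbb R^n)$: $$m!\,N_0\big((R(f^{i_1\dots i_k}))_{p_1q_1\dots p_{m-k}q_{m-k}}\big)=\sigma(i_1\dots i_k)\sum_{r=0}^k(-1)^r\binom kr\frac{\partial^r}{\partial x_{i_1}\cdots\partial x_{i_r}}\big(R^{k-r}(G_{m-r})\big)_{p_1q_1\dots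 p_{m-k}q_{m-k}\,i_{r+1}\dots i_k}.$$ -/

import Mathlib

open scoped ContDiff Distributions Convolution LineDeriv
open MeasureTheory TopologicalSpace

noncomputable section

namespace MomentumRay

/-- The Euclidean space `ℝⁿ`. -/
abbrev Eucl (n : ℕ) := EuclideanSpace ℝ (Fin n)

/-- The standard basis vector `e_a` of `ℝⁿ`. -/
abbrev basisVec {n : ℕ} (a : Fin n) : Eucl n := EuclideanSpace.single a (1 : ℝ)

/-! ### Smooth functions, distributions and compactly supported distributions

As for Mathlib's `𝓓'(Ω, ℂ)`, complex valued distributions are `ℝ`-linear functionals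
with values in `ℂ` that are tested against real valued functions. -/

/-- The space `C^∞(ℝⁿ)` of real valued smooth functions. -/
def SmoothFun (n : ℕ) : Submodule ℝ (Eucl n → ℝ) where
  carrier := {φ | ContDiff ℝ ∞ φ}
  add_mem' {φ ψ} (hφ : ContDiff ℝ ∞ φ) (hψ : ContDiff ℝ ∞ ψ) := hφ.add hψ
  zero_mem' := show ContDiff ℝ ∞ (fun _ : Eucl n => (0 : ℝ)) from contDiff_const
  smul_mem' _ φ (hφ : ContDiff ℝ ∞ φ) := contDiff_const.smul hφ

theorem contDiff_coe {n : ℕ} (φ : SmoothFun n) : ContDiff ℝ ∞ (φ : Eucl n → ℝ) := φ.2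

/-- The space `𝓓'(ℝⁿ)` of complex valued distributions on `ℝⁿ`. -/
abbrev Distr (n : ℕ) := 𝓓'((⊤ : Opens (Eucl n)), ℂ)

/-- The space `𝓔'(ℝⁿ)` of compactly supported complex valued distributions, i.e. the dual of the
Fréchet space `C^∞(ℝⁿ)`: linear functionals `T` that are continuous for the seminorms
`max_{j ≤ N} sup_K ‖D^j φ‖` with `K` compact, that is,
`|T φ| ≤ C max_{j ≤ N} sup_K ‖D^j φ‖` for some `K`, `N` and `C`. -/
def CompactDistr (n : ℕ) : Submodule ℝ (SmoothFun n →ₗ[ℝ] ℂ) where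
  carrier := {T | ∃ (K : Compacts (Eucl n)) (N : ℕ) (C : ℝ), 0 ≤ C ∧
    ∀ (φ : SmoothFun n) (M : ℝ), 0 ≤ M →
      (∀ j ≤ N, ∀ x ∈ K, ‖iteratedFDeriv ℝ j (φ : Eucl n → ℝ) x‖ ≤ M) → ‖T φ‖ ≤ C * M}
  add_mem' := by
    rintro S T ⟨K, N, C, hC, h⟩ ⟨K', N', C', hC', h'⟩
    refine ⟨K ⊔ K', max N N', C + C', add_nonneg hC hC', fun φ M hM hφ => ?_⟩
    have h1 := h φ M hM fun j hj x hx =>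
      hφ j (hj.trans (le_max_left _ _)) x (Or.inl hx)
    have h2 := h' φ M hM fun j hj x hx =>
      hφ j (hj.trans (le_max_right _ _)) x (Or.inr hx)
    calc ‖(S + T) φ‖ ≤ ‖S φ‖ + ‖T φ‖ := norm_add_le _ _
      _ ≤ (C + C') * M := by linarith
  zero_mem' := ⟨⊥, 0, 0, le_rfl, fun φ M hM _ => by simp⟩
  smul_mem' := by
    rintro c T ⟨K, N, C, hC, h⟩
    refine ⟨K, N, ‖c‖ * C, by positivity, fun φ M hM hφ => ?_⟩
    rw [LinearMap.smul_apply, norm_smul, mul_assoc]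
    exact mul_le_mul_of_nonneg_left (h φ M hM hφ) (norm_nonneg c)

/-- The derivative of a smooth function in the direction `v`. -/
def dirDeriv {n : ℕ} (v : Eucl n) : SmoothFun n →ₗ[ℝ] SmoothFun n where
  toFun φ := ⟨fun x => fderiv ℝ (φ : Eucl n → ℝ) x v,
    ((contDiff_coe φ).fderiv_right (m := ∞) le_rfl).clm_apply contDiff_const⟩
  map_add' φ ψ := by
    have hφ : Differentiable ℝ (φ : Eucl n → ℝ) := (contDiff_coe φ).differentiable (by simp)
    have hψ : Differentiable ℝ (ψ : Eucl n → ℝ) := (contDiff_coe ψ).differentiable (by simp)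
    refine Subtype.ext (funext fun x => ?_)
    simp [fderiv_add (hφ x) (hψ x)]
  map_smul' c φ := by
    have hφ : Differentiable ℝ (φ : Eucl n → ℝ) := (contDiff_coe φ).differentiable (by simp)
    refine Subtype.ext (funext fun x => ?_)
    simp [fderiv_const_smul (hφ x)]

/-- Derivatives of compactly supported distributions: `(∂_v T)(φ) = -T(∂_v φ)`. -/
instance CompactDistr.instLineDeriv (n : ℕ) :
    LineDeriv (Eucl n) (CompactDistr n) (CompactDistr n) where
  lineDerivOp v T := ⟨-((T : SmoothFun n →ₗ[ℝ] ℂ).comp (dirDeriv v)), by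
    obtain ⟨K, N, C, hC, h⟩ := T.2
    let ev : (Eucl n →L[ℝ] ℝ) →L[ℝ] ℝ := ContinuousLinearMap.apply ℝ ℝ v
    refine ⟨K, N + 1, C * ‖ev‖, by positivity, fun φ M hM hφ => ?_⟩
    have key : ‖(T : SmoothFun n →ₗ[ℝ] ℂ) (dirDeriv v φ)‖ ≤ C * (‖ev‖ * M) := by
      refine h _ _ (by positivity) fun j hj x hx => ?_
      have hs : ContDiff ℝ ∞ (fderiv ℝ (φ : Eucl n → ℝ)) :=
        (contDiff_coe φ).fderiv_right (m := ∞) le_rfl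
      have h1 := ev.norm_iteratedFDeriv_comp_left (f := fderiv ℝ (φ : Eucl n → ℝ)) (x := x)
        (n := j) (N := ∞) hs.contDiffAt (by exact_mod_cast le_top)
      rw [norm_iteratedFDeriv_fderiv] at h1
      exact h1.trans (mul_le_mul_of_nonneg_left (hφ (j + 1) (by omega) x hx) (norm_nonneg ev))
    rw [LinearMap.neg_apply, norm_neg, mul_assoc]
    exact key⟩

/-- Multiplication of test functions by a smooth function. -/
def mulTest {n : ℕ} (g : SmoothFun n) :
    𝓓((⊤ : Opens (Eucl n)), ℝ) →L[ℝ] 𝓓((⊤ : Opens (Eucl n)), ℝ) :=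
  TestFunction.limitCLM ℝ
    (fun φ => ⟨fun x => φ x * (g : Eucl n → ℝ) x, φ.contDiff.mul (contDiff_coe g),
      φ.hasCompactSupport.mul_right, fun _ _ => trivial⟩)
    (fun K hK => TestFunction.ofSupportedInCLM ℝ hK ∘L
      ContDiffMapSupportedIn.bilinLeftCLM (ContinuousLinearMap.mul ℝ ℝ) (K := K) (contDiff_coe g))
    (fun _ _ _ => rfl)

/-- The product `g T` of a smooth function and a distribution: `(g T)(φ) = T(g φ)`. -/
def smoothMul {n : ℕ} (g : SmoothFun n) (T : Distr n) : Distr n :=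
  (mulTest g).precompCompactConvergenceCLM ℂ T

open scoped Pointwise in
theorem locallyIntegrable_neg_arg {n : ℕ} {h : Eucl n → ℝ} (hh : LocallyIntegrable h) :
    LocallyIntegrable (fun z => h (-z)) := by
  rw [locallyIntegrable_iff] at hh ⊢
  intro K hK
  have h1 : IntegrableOn h (-K) := hh (-K) hK.neg
  have h2 := ((Measure.measurePreserving_neg (volume : Measure (Eucl n))).integrableOn_comp_preimage
    (MeasurableEquiv.neg (Eucl n)).measurableEmbedding).2 h1
  simpa [Function.comp_def] using h2

/-- The smooth function `y ↦ ∫ h(x - y) φ(x) dx`, for `φ` a test function and `h` locally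
integrable. -/
def corrFun {n : ℕ} {h : Eucl n → ℝ} (hh : LocallyIntegrable h)
    (φ : 𝓓((⊤ : Opens (Eucl n)), ℝ)) : SmoothFun n :=
  ⟨fun y => ∫ x, h (x - y) * φ x, by
    have h1 : (fun y => ∫ x, h (x - y) * φ x) =
        (fun z => h (-z)) ⋆[ContinuousLinearMap.lsmul ℝ ℝ, volume] φ := by
      ext y
      rw [convolution_eq_swap]
      simp
    have h2 := φ.hasCompactSupport.contDiff_convolution_right
      (ContinuousLinearMap.lsmul ℝ ℝ) (locallyIntegrable_neg_arg hh) φ.contDiff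
    rw [← h1] at h2
    exact h2⟩

open scoped Pointwise in
theorem norm_iteratedFDeriv_convolution_le {n : ℕ} {h : Eucl n → ℝ} (hh : LocallyIntegrable h)
    (K L : Compacts (Eucl n)) (j : ℕ) {F : Type} [NormedAddCommGroup F] [NormedSpace ℝ F]
    [CompleteSpace F] (φ : Eucl n → F) (hφ : ContDiff ℝ ∞ φ) (hK : tsupport φ ⊆ K) {M : ℝ}
    (hM : ∀ x, ‖iteratedFDeriv ℝ j φ x‖ ≤ M) {y : Eucl n} (hy : y ∈ L) :
    ‖iteratedFDeriv ℝ j (h ⋆[ContinuousLinearMap.lsmul ℝ ℝ, volume] φ) y‖ ≤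
      (∫ t in (L : Set (Eucl n)) - (K : Set (Eucl n)), ‖h t‖) * M := by
  have hc : HasCompactSupport φ := K.isCompact.of_isClosed_subset (isClosed_tsupport φ) hK
  have hLK : IsCompact ((L : Set (Eucl n)) - (K : Set (Eucl n))) := by
    rw [sub_eq_add_neg]; exact L.isCompact.add K.isCompact.neg
  induction j generalizing F with
  | zero =>
    simp only [norm_iteratedFDeriv_zero] at hM ⊢
    rw [convolution_def, ← integral_mul_const]
    have hz : ∀ t, t ∉ (L : Set (Eucl n)) - (K : Set (Eucl n)) →
        (ContinuousLinearMap.lsmul ℝ ℝ) (h t) (φ (y - t)) = 0 := by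
      intro t ht
      have : φ (y - t) = 0 := by
        by_contra hne
        exact ht ⟨y, hy, y - t, hK (subset_tsupport _ hne), by simp⟩
      simp [this]
    rw [← setIntegral_eq_integral_of_forall_compl_eq_zero hz]
    refine norm_integral_le_of_norm_le ?_ (Filter.Eventually.of_forall fun t => ?_)
    · exact ((hh.integrableOn_isCompact hLK).norm).mul_const M
    · simp only [ContinuousLinearMap.lsmul_apply, norm_smul]
      exact mul_le_mul_of_nonneg_left (hM _) (norm_nonneg _)
  | succ j ih =>
    have hfd : fderiv ℝ (h ⋆[ContinuousLinearMap.lsmul ℝ ℝ, volume] φ) =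
        h ⋆[ContinuousLinearMap.lsmul ℝ ℝ, volume] (fderiv ℝ φ) := by
      ext1 x
      rw [(hc.hasFDerivAt_convolution_right (ContinuousLinearMap.lsmul ℝ ℝ) hh
        (hφ.of_le (by exact_mod_cast le_top)) x).fderiv]
      rfl
    rw [← norm_iteratedFDeriv_fderiv, hfd]
    have hs := (tsupport_fderiv_subset ℝ (f := φ)).trans hK
    refine ih (fderiv ℝ φ) (hφ.fderiv_right (m := ∞) le_rfl) hs (fun x => ?_)
      (K.isCompact.of_isClosed_subset (isClosed_tsupport _) hs)
    rw [norm_iteratedFDeriv_fderiv]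
    exact hM x

theorem corrFun_coe {n : ℕ} {h : Eucl n → ℝ} (hh : LocallyIntegrable h)
    (φ : 𝓓((⊤ : Opens (Eucl n)), ℝ)) : (corrFun hh φ : Eucl n → ℝ) =
      (fun z => h (-z)) ⋆[ContinuousLinearMap.lsmul ℝ ℝ, volume] φ := by
  ext y
  rw [convolution_eq_swap]
  simp [corrFun]

theorem integrable_corr {n : ℕ} {h : Eucl n → ℝ} (hh : LocallyIntegrable h)
    (φ : 𝓓((⊤ : Opens (Eucl n)), ℝ)) (y : Eucl n) :
    Integrable (fun x => h (x - y) * φ x) := by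
  have h1 := φ.hasCompactSupport.convolutionExists_right (ContinuousLinearMap.lsmul ℝ ℝ)
    (locallyIntegrable_neg_arg hh) φ.continuous y
  simpa using h1.integrable_swap

theorem corrFun_add {n : ℕ} {h : Eucl n → ℝ} (hh : LocallyIntegrable h)
    (φ ψ : 𝓓((⊤ : Opens (Eucl n)), ℝ)) :
    corrFun hh (φ + ψ) = corrFun hh φ + corrFun hh ψ := by
  refine Subtype.ext (funext fun y => ?_)
  have := integral_add (integrable_corr hh φ y) (integrable_corr hh ψ y)
  simpa [corrFun, mul_add] using this

theorem corrFun_smul {n : ℕ} {h : Eucl n → ℝ} (hh : LocallyIntegrable h) (c : ℝ)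
    (φ : 𝓓((⊤ : Opens (Eucl n)), ℝ)) : corrFun hh (c • φ) = c • corrFun hh φ := by
  refine Subtype.ext (funext fun y => ?_)
  have := integral_const_mul (μ := (volume : Measure (Eucl n))) c (fun x => h (x - y) * φ x)
  simp only [corrFun, Submodule.coe_smul, Pi.smul_apply, smul_eq_mul]
  rw [← this]
  congr 1
  ext x
  simp only [FunLike.coe_smul, Pi.smul_apply, smul_eq_mul]
  ring

/-- The convolution `T * h ∈ 𝓓'(ℝⁿ)` of a compactly supported distribution `T` and a locally
integrable function `h`: `⟨T * h, φ⟩ = ⟨T_y, ∫ h(x - y) φ(x) dx⟩`. -/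
def conv {n : ℕ} (T : CompactDistr n) {h : Eucl n → ℝ} (hh : LocallyIntegrable h) : Distr n :=
  TestFunction.mkCLM ℝ (fun φ => (T : SmoothFun n →ₗ[ℝ] ℂ) (corrFun hh φ))
    (fun φ ψ => by simp only [corrFun_add, map_add])
    (fun c φ => by simp only [corrFun_smul, map_smul])
    (fun K hK => by
      obtain ⟨L, N, C, hC, hT⟩ := T.2
      refine (ContDiffMapSupportedIn.mkCLMtoNormedSpace ℝ
        (fun φ => (T : SmoothFun n →ₗ[ℝ] ℂ) (corrFun hh (TestFunction.ofSupportedIn hK φ)))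
        (fun φ ψ => ?_) (fun c φ => ?_) ⟨Finset.range (N + 1), C * ∫ t in Set.image2 (· - ·)
          (L : Set (Eucl n)) K, ‖h (-t)‖, mul_nonneg hC (integral_nonneg fun _ => norm_nonneg _),
          fun φ => ?_⟩).continuous
      · rw [← map_add, ← corrFun_add]; rfl
      · rw [← map_smul, ← corrFun_smul]; rfl
      · rw [mul_assoc]
        refine hT _ _ (mul_nonneg (integral_nonneg fun _ => norm_nonneg _) (apply_nonneg _ _))
          fun j hj y hy => ?_
        rw [corrFun_coe]
        refine norm_iteratedFDeriv_convolution_le (locallyIntegrable_neg_arg hh) K L j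
          (TestFunction.ofSupportedIn hK φ) φ.contDiff φ.tsupport_subset (fun x => ?_) hy
        have hle : ContDiffMapSupportedIn.seminorm ℝ (Eucl n) ℝ ⊤ K j ≤
            (Finset.range (N + 1)).sup fun i => ContDiffMapSupportedIn.seminorm ℝ _ ℝ ⊤ K i :=
          Finset.le_sup (f := fun i => ContDiffMapSupportedIn.seminorm ℝ (Eucl n) ℝ ⊤ K i)
            (Finset.mem_range.2 (Nat.lt_succ_of_le hj))
        exact (ContDiffMapSupportedIn.norm_iteratedFDeriv_apply_le_seminorm_top ℝ).trans (hle φ))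

/-! ### Tensor fields -/

/-- Tensor fields of rank `m` on `ℝⁿ` with components in `A` (a space of distributions), given by
their components `u_{i_1 … i_m}` in the standard basis. -/
abbrev TensorField (A : Type*) (n m : ℕ) := (Fin m → Fin n) → A

namespace TensorField

variable {A : Type*} [AddCommGroup A] [Module ℝ A] {n : ℕ}

/-- A tensor field is symmetric if its components are invariant under permutations. -/
def IsSymm {A : Type*} {n m : ℕ} (u : TensorField A n m) : Prop :=
  ∀ (π : Equiv.Perm (Fin m)) (I : Fin m → Fin n), u (I ∘ π) = u I

/-- Transport of a tensor field along an equality of ranks. -/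
def cast {A : Type*} {n a b : ℕ} (h : a = b) (u : TensorField A n a) : TensorField A n b :=
  fun I => u (I ∘ Fin.cast h)

/-- The symmetrization
`(σ u)_{i_1 … i_m} = (1 / m!) ∑_π u_{i_{π(1)} … i_{π(m)}}`. -/
def symm {m : ℕ} (u : TensorField A n m) : TensorField A n m :=
  fun I => ((m.factorial : ℝ)⁻¹) • ∑ π : Equiv.Perm (Fin m), u (I ∘ π)

/-- The operator `i` of symmetric multiplication by the Euclidean metric,
`(i u)_{i_1 … i_{m+2}} = σ(i_1 … i_{m+2}) δ_{i_1 i_2} u_{i_3 … i_{m+2}}`. -/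
def metricMul {m : ℕ} (u : TensorField A n m) : TensorField A n (m + 2) :=
  symm fun I => if I 0 = I 1 then u (fun a => I a.succ.succ) else 0

/-- The contraction `j` with the Euclidean metric,
`(j u)_{i_1 … i_m} = ∑_a u_{i_1 … i_m a a}`. -/
def metricContract {m : ℕ} (u : TensorField A n (m + 2)) : TensorField A n m :=
  fun I => ∑ a : Fin n, u (Fin.snoc (Fin.snoc I a : Fin (m + 1) → Fin n) a : Fin (m + 2) → Fin n)

/-- The power `i^l`. -/
def metricMulPow {m : ℕ} : (l : ℕ) → TensorField A n m → TensorField A n (m + 2 * l)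
  | 0, u => u
  | l + 1, u => metricMul (metricMulPow l u)

/-- The power `j^l`. -/
def metricContractPow {m : ℕ} : (l : ℕ) → TensorField A n (m + 2 * l) → TensorField A n m
  | 0, u => u
  | l + 1, u => metricContractPow l (metricContract u)

/-- The operator `i^l j^l` on tensor fields of rank `s ≥ 2 l`. -/
def mulContract {s : ℕ} (l : ℕ) (hl : 2 * l ≤ s) (u : TensorField A n s) : TensorField A n s :=
  cast (Nat.sub_add_cancel hl)
    (metricMulPow l (metricContractPow l (cast (Nat.sub_add_cancel hl).symm u)))

variable [LineDeriv (Eucl n) A A]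

/-- The divergence `(δ u)_{i_1 … i_m} = ∑_a ∂u_{i_1 … i_m a} / ∂x_a`. -/
def div {m : ℕ} (u : TensorField A n (m + 1)) : TensorField A n m :=
  fun I => ∑ a : Fin n, ∂_{basisVec a} (u (Fin.snoc I a : Fin (m + 1) → Fin n))

/-- The iterated divergence `δ^p`. -/
def divPow {m : ℕ} : (p : ℕ) → TensorField A n (m + p) → TensorField A n m
  | 0, u => u
  | p + 1, u => divPow p (div u)

/-- The alternation `α(p_j q_j)` in the `j`-th indices of the two groups of indices
`p_1, …, p_s` and `q_1, …, q_s`. -/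
def alt {A : Type*} [AddCommGroup A] [Module ℝ A] {n s : ℕ} (j : Fin s)
    (U : (Fin s → Fin n) → (Fin s → Fin n) → A) : (Fin s → Fin n) → (Fin s → Fin n) → A :=
  fun p q => (1 / 2 : ℝ) •
    (U p q - U (Function.update p j (q j)) (Function.update q j (p j)))

/-- The operator `R`,
`(R u)_{p_1 q_1 … p_s q_s} = α(p_1 q_1) … α(p_s q_s) ∂^s u_{p_1 … p_s} / ∂x_{q_1} … ∂x_{q_s}`. -/
def R {s : ℕ} (u : TensorField A n s) : (Fin s → Fin n) → (Fin s → Fin n) → A :=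
  (List.finRange s).foldr alt (fun p q => ∂^{fun j => basisVec (q j)} (u p))

/-- The tensor field `u^{i_1 … i_k}` of rank `s` that is obtained from the tensor field `u` of rank
`m = s + k` by fixing the last `k` indices: `(u^{i})_p = u_{p i}`. -/
def fixIdx {A : Type*} {n m s k : ℕ} (h : s + k = m) (u : TensorField A n m) (i : Fin k → Fin n) :
    TensorField A n s :=
  fun p => cast h.symm u (Fin.append p i)

/-- The generalized operator `(R^k u)_{p_1 q_1 … p_s q_s i_1 … i_k} = (R u^{i_1 … i_k})_{p_1 q_1 …
p_s q_s}` for tensor fields of rank `m = s + k`. -/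
def Rgen {m s k : ℕ} (h : s + k = m) (u : TensorField A n m) (p q : Fin s → Fin n)
    (i : Fin k → Fin n) : A :=
  R (fixIdx h u i) p q

end TensorField

/-! ### Normal operators of the momentum ray transforms -/

/-- The smooth function `x ↦ x_{p_1} ⋯ x_{p_b}`, a component of `x^{⊙ b}`. -/
def monomialFun {n b : ℕ} (P : Fin b → Fin n) : SmoothFun n :=
  ⟨fun x => ∏ j, x (P j), show ContDiff ℝ ∞ (fun x : Eucl n => ∏ j, x (P j)) by fun_prop⟩

/-- The contraction `j_{x^{⊙ b}}`,
`(j_{x^{⊙ b}} u)_{i_1 … i_a} = x_{p_1} ⋯ x_{p_b} u_{i_1 … i_a p_1 … p_b}`. -/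
def contractX {n a b : ℕ} (u : TensorField (Distr n) n (a + b)) : TensorField (Distr n) n a :=
  fun I => ∑ P : Fin b → Fin n, smoothMul (monomialFun P) (u (Fin.append I P))

/-- The kernel `x_{p_1} ⋯ x_{p_{2k-l}} x_{i_1} ⋯ x_{i_m} x_{j_1} ⋯ x_{j_m} / |x|^{2m+2k-2l+n-1}`
(it is used for `l ≤ k` and `n ≥ 1`). -/
def momentKernel {n m k l : ℕ} (P : Fin (2 * k - l) → Fin n) (I J : Fin m → Fin n)
    (x : Eucl n) : ℝ :=
  (∏ a, x (P a)) * (∏ a, x (I a)) * (∏ a, x (J a)) / ‖x‖ ^ (2 * m + 2 * (k - l) + (n - 1))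

theorem abs_prod_coord_le {n b : ℕ} (P : Fin b → Fin n) (x : Eucl n) :
    |∏ a, x (P a)| ≤ ‖x‖ ^ b := by
  rw [Finset.abs_prod]
  calc ∏ a, |x (P a)| ≤ ∏ _a : Fin b, ‖x‖ :=
        Finset.prod_le_prod (fun _ _ => abs_nonneg _) fun a _ => by
          simpa using PiLp.norm_apply_le x (P a)
    _ = ‖x‖ ^ b := by simp

theorem momentKernel_locallyIntegrable {n m k l : ℕ} (P : Fin (2 * k - l) → Fin n)
    (I J : Fin m → Fin n) :
    LocallyIntegrable (momentKernel P I J : Eucl n → ℝ) := by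
  rcases Nat.eq_zero_or_pos n with rfl | hn
  · exact (continuous_of_const fun x y => by rw [Subsingleton.elim x y]).locallyIntegrable
  have : Nonempty (Fin n) := ⟨⟨0, hn⟩⟩
  have hmeas : Measurable (momentKernel P I J : Eucl n → ℝ) := by
    unfold momentKernel
    fun_prop
  refine locallyIntegrable_of_norm_le_rpow (C := 1)
    (α := ((2 * m + 2 * (k - l) + (n - 1) : ℕ) : ℝ) - ((2 * k - l + m + m : ℕ) : ℝ))
    (by rw [finrank_euclideanSpace, Fintype.card_fin]; exact hn) ?_ ?_ hmeas.aestronglyMeasurable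
  · have h1 : 2 * m + 2 * (k - l) + (n - 1) < n + (2 * k - l + m + m) := by omega
    have h2 : ((2 * m + 2 * (k - l) + (n - 1) : ℕ) : ℝ) < ((n + (2 * k - l + m + m) : ℕ) : ℝ) := by
      exact_mod_cast h1
    rw [Nat.cast_add n] at h2
    simp only [finrank_euclideanSpace, Fintype.card_fin]
    linarith
  · filter_upwards [Measure.ae_ne volume (0 : Eucl n)] with x hx
    have hx' : 0 < ‖x‖ := norm_pos_iff.2 hx
    rw [one_mul, neg_sub, Real.rpow_sub hx', Real.rpow_natCast, Real.rpow_natCast, momentKernel,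
      norm_div, norm_pow, norm_norm]
    gcongr
    rw [norm_mul, norm_mul, pow_add, pow_add]
    gcongr
    · exact abs_prod_coord_le P x
    · exact abs_prod_coord_le I x
    · exact abs_prod_coord_le J x

/-- The normal operator `N_m^k = (I_m^k)^* I_m^k : 𝓔'(ℝⁿ; S^m) → 𝓓'(ℝⁿ; S^m)` of the `k`-th momentum
ray transform,
`(N_m^k f)_{i_1 … i_m} = 2 ∑_{l=0}^k C(k,l) (-1)^l x_{p_1} ⋯ x_{p_{2k-l}}
  [f_{j_1 … j_m} * (x_{p_1} ⋯ x_{p_{2k-l}} x_{i_1} ⋯ x_{i_m} x_{j_1} ⋯ x_{j_m} / |x|^{2m+2k-2l+n-1})]`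
with summation over repeated indices. -/
def normalOp {n m : ℕ} (k : ℕ) (f : TensorField (CompactDistr n) n m) :
    TensorField (Distr n) n m :=
  fun I => (2 : ℝ) • ∑ l ∈ Finset.range (k + 1), ((k.choose l : ℝ) * (-1) ^ l) •
    ∑ P : Fin (2 * k - l) → Fin n, smoothMul (monomialFun P)
      (∑ J : Fin m → Fin n, conv (f J) (momentKernel_locallyIntegrable P I J))

/-- The normal operator `N_0 = N_0^0` of the ray transform of scalar functions. -/
def normalOpScalar {n : ℕ} (T : CompactDistr n) : Distr n :=
  normalOp (m := 0) 0 (fun _ => T) Fin.elim0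

/-- The constants `c_{l,s} = (∏_{w=0}^{s-l-1} (n - 1 + 2w)) (-1)^l s! / (2^l l! (s-2l)!)`. -/
def coeffC (n l s : ℕ) : ℝ :=
  (∏ w ∈ Finset.range (s - l), ((n : ℝ) - 1 + 2 * w)) *
    ((-1) ^ l * s.factorial / (2 ^ l * l.factorial * (s - 2 * l).factorial))

/-- The tensor field
`∑_{p=0}^r (-1)^{r-p} (1/p!) C(r,p) j_{x^{⊙(r-p)}} δ^p N_m^p f` of rank `m - r`. -/
def momentSum {n m : ℕ} (r : ℕ) (hr : r ≤ m) (f : TensorField (CompactDistr n) n m) :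
    TensorField (Distr n) n (m - r) :=
  ∑ p : Fin (r + 1), ((-1) ^ (r - p : ℕ) * ((p : ℕ).factorial : ℝ)⁻¹ * (r.choose p : ℝ)) •
    contractX (b := r - p) (TensorField.divPow (p : ℕ)
      (TensorField.cast (by omega : m = m - r + (r - p) + p) (normalOp p f)))

/-- The tensor field `G_{m-r} = ∑_{l=0}^{⌊(m-r)/2⌋} c_{l,m-r} i^l j^l (momentSum r)`. -/
def fieldG {n m : ℕ} (r : ℕ) (hr : r ≤ m) (f : TensorField (CompactDistr n) n m) :
    TensorField (Distr n) n (m - r) :=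
  ∑ l : Fin ((m - r) / 2 + 1), coeffC n l (m - r) •
    TensorField.mulContract (l : ℕ) (by omega) (momentSum r hr f)

end MomentumRay

end

/-!
Everything rests on a convolution formula for `G_{m-r}` whose right-hand side is a derivative of
`|z|^{-(n-1)}`; the identity between `N_0 R f` and the `R^{k-r} G_{m-r}` is then an identity between
polynomials in commuting variables.

*The convolution formula.* Put `z = x - y = t θ` with `|θ| = 1`. Up to the weight `|t|^{n-1}`, the
kernel of `N_m^p` is `2 (x · θ)^p (y · θ)^p θ^{⊗ 2m}` (`normalDensity_line`), so it is not
translation invariant for `p ≥ 1`. After pairing with a test function, `δ^p` is a `p`-th derivative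
in `t`, which integration by parts along the line moves to the polynomial `(x · θ)^p`. There are no
boundary terms because all of the line is used (`integral_eq_zero_of_forall_line`), not a ray from
`y`. What remains of `∑_p (-1)^{r-p} (1/p!) C(r,p) j_{x^{⊙(r-p)}} δ^p N_m^p f` is, by the binomial
theorem, `(y · θ - x · θ)^r = (-t)^r`, and hence (`momentSum_eq`) the sum equals
`2 (-1)^r ∑_J f_J * (z_I z_J / |z|^{2(m-r)+n-1})`. The constants `c_{l,s}` are the coefficients of
`∂^s |z|^{-(n-1)} = (-1)^s ∑_l c_{l,s} i^l z^{⊗(s-2l)} |z|^{-(n-1)-2(s-l)}`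
(`TensorField.partials_regPow`, by polarization from `SmoothFun.dirDeriv_pow_regPow`), and
`j^l z^{⊗ s} = |z|^{2l} z^{⊗(s-2l)}`. So (`fieldG_eq`)
`G_{m-r} = 2 (-1)^m ∑_J f_J * (z_J ∂^{m-r} |z|^{-(n-1)})`, which is visibly symmetric.

*The algebra.* All derivatives in the identity fall on products `z_J · h` with `h = |z|^{-(n-1)}`.
Let `X_a` and `Y_a` denote `∂_a` acting on `z_J` and on `h`. By the Leibniz rule an outer derivative
is `X_a + Y_a`, and `G_{m-r}` has the symbol `∏ Y_{i_a}`. The alternating sum over `r` becomes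
`∏_{a ≤ k} (Y_{i_a} - (X_{i_a} + Y_{i_a})) = (-1)^k ∏ X_{i_a}`, while each alternation turns
`(X_q + Y_q) Y_p` into minus what it makes of `(X_q + Y_q) X_p`. The right-hand side therefore has
the symbol of `(-1)^m R(∂_{p_1} ⋯ ∂_{p_{m-k}} ∂_{i_1} ⋯ ∂_{i_k} z_J · h)` (`Symb.sum_symm_R_right`).
Since `∂^m z_J` is constant and `f` is symmetric, summation against `f_J` gives `m! f_{p i} * h`,
i.e. `m! N_0 f_{p i} / 2`.

*Singularities.* The kernels of `G_{m-r}` are locally integrable, but those of its derivatives in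
general are not, so the algebra is done with the smooth functions
`h_j = (|z|² + 1/(j+1))^{-(n-1)/2}`. The relation `ConvergesTo` between symbols and distributions,
given by the weak limit `j → ∞`, is linear and compatible with derivatives, hence with `R` and
symmetrization; it relates `∏ Y_{i_a}` to `G_{m-r}` and `∏ X_{i_a}` to `m! N_0 f_i` (up to sign) by
dominated convergence. Uniqueness of limits then transfers the identity between symbols to
distributions.
-/

open scoped ContDiff Distributions Convolution LineDeriv
open MeasureTheory TopologicalSpace

noncomputable section

namespace MomentumRay

namespace TensorField

/-! ### Relations that are compatible with the operations on tensor fields -/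

/-- A relation between two real vector spaces that is a linear subspace of their product. The
relations used below are graphs of linear maps and convergence of families of distributions; every
tensor operation built from linear combinations respects such a relation. -/
structure IsLinearRel {A B : Type*} [AddCommGroup A] [Module ℝ A] [AddCommGroup B] [Module ℝ B]
    (Rel : A → B → Prop) : Prop where
  zero : Rel 0 0
  add : ∀ {a b a' b'}, Rel a b → Rel a' b' → Rel (a + a') (b + b')
  smul : ∀ (c : ℝ) {a b}, Rel a b → Rel (c • a) (c • b)

theorem iteratedLineDeriv_rel {A B : Type*} {n : ℕ} [LineDeriv (Eucl n) A A]
    [LineDeriv (Eucl n) B B] {Rel : A → B → Prop}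
    (hd : ∀ (c : Fin n) {a b}, Rel a b → Rel (∂_{basisVec c} a) (∂_{basisVec c} b))
    {r : ℕ} (i : Fin r → Fin n) {a : A} {b : B} (hab : Rel a b) :
    Rel (∂^{fun j => basisVec (i j)} a) (∂^{fun j => basisVec (i j)} b) := by
  induction r with
  | zero => exact hab
  | succ r ih => exact hd _ (ih (Fin.tail i))

section Rel

variable {A B : Type*} [AddCommGroup A] [Module ℝ A] [AddCommGroup B] [Module ℝ B]
  {Rel : A → B → Prop} {n : ℕ}

theorem IsLinearRel.sum (h : IsLinearRel Rel) {ι : Type*} (s : Finset ι) {a : ι → A} {b : ι → B}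
    (hab : ∀ i, Rel (a i) (b i)) : Rel (∑ i ∈ s, a i) (∑ i ∈ s, b i) := by
  classical
  induction s using Finset.induction_on with
  | empty => simpa using h.zero
  | insert i s hi ih => simpa [Finset.sum_insert hi] using h.add (hab i) ih

theorem IsLinearRel.sub (h : IsLinearRel Rel) {a a' : A} {b b' : B}
    (hab : Rel a b) (hab' : Rel a' b') : Rel (a - a') (b - b') := by
  simpa [sub_eq_add_neg] using h.add hab (h.smul (-1) hab')

theorem IsLinearRel.symm (h : IsLinearRel Rel) {m : ℕ} {u : TensorField A n m}
    {v : TensorField B n m} (huv : ∀ I, Rel (u I) (v I)) (I : Fin m → Fin n) :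
    Rel (TensorField.symm u I) (TensorField.symm v I) :=
  h.smul _ (h.sum _ fun _ => huv _)

theorem IsLinearRel.metricMulPow (h : IsLinearRel Rel) {m : ℕ} (l : ℕ) {u : TensorField A n m}
    {v : TensorField B n m} (huv : ∀ I, Rel (u I) (v I)) :
    ∀ I, Rel (TensorField.metricMulPow l u I) (TensorField.metricMulPow l v I) := by
  induction l with
  | zero => exact huv
  | succ l ih =>
    refine fun I => h.smul _ (h.sum _ fun π => ?_)
    dsimp only
    split_ifs
    exacts [ih _, h.zero]

theorem IsLinearRel.metricContractPow (h : IsLinearRel Rel) {m : ℕ} (l : ℕ)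
    {u : TensorField A n (m + 2 * l)} {v : TensorField B n (m + 2 * l)}
    (huv : ∀ I, Rel (u I) (v I)) :
    ∀ I, Rel (TensorField.metricContractPow l u I) (TensorField.metricContractPow l v I) := by
  induction l with
  | zero => exact huv
  | succ l ih => exact ih fun I => h.sum _ fun a => huv _

theorem IsLinearRel.mulContract (h : IsLinearRel Rel) {s : ℕ} (l : ℕ) (hl : 2 * l ≤ s)
    {u : TensorField A n s} {v : TensorField B n s} (huv : ∀ I, Rel (u I) (v I)) :
    ∀ I, Rel (TensorField.mulContract l hl u I) (TensorField.mulContract l hl v I) :=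
  fun _ => h.metricMulPow l (h.metricContractPow l fun _ => huv _) _

variable [LineDeriv (Eucl n) A A] [LineDeriv (Eucl n) B B]

theorem IsLinearRel.R (h : IsLinearRel Rel)
    (hd : ∀ (c : Fin n) {a b}, Rel a b → Rel (∂_{basisVec c} a) (∂_{basisVec c} b))
    {s : ℕ} {u : TensorField A n s} {v : TensorField B n s} (huv : ∀ I, Rel (u I) (v I))
    (p q : Fin s → Fin n) : Rel (TensorField.R u p q) (TensorField.R v p q) := by
  unfold TensorField.R
  induction List.finRange s generalizing p q with
  | nil => exact iteratedLineDeriv_rel hd q (huv p)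
  | cons j l ih => exact h.smul _ (h.sub (ih _ _) (ih _ _))

end Rel

/-! ### The identity for symbols -/

section Alternation

variable {S : Type*} [CommRing S] [Algebra ℝ S] {n s : ℕ}

theorem alt_prod (c : S) (G : Fin s → Fin n → Fin n → S) (j : Fin s) (p q : Fin s → Fin n) :
    alt j (fun p q => c * ∏ i, G i (p i) (q i)) p q =
      c * ∏ i,
        Function.update G j (fun a b => (1 / 2 : ℝ) • (G j a b - G j b a)) i (p i) (q i) := by
  classical
  have h1 : ∀ i ∈ Finset.univ.erase j, G i (Function.update p j (q j) i)
      (Function.update q j (p j) i) = G i (p i) (q i) := fun i hi => by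
    rw [Function.update_of_ne (Finset.ne_of_mem_erase hi),
      Function.update_of_ne (Finset.ne_of_mem_erase hi)]
  have h2 : ∀ i ∈ Finset.univ.erase j, Function.update G j
      (fun a b => (1 / 2 : ℝ) • (G j a b - G j b a)) i (p i) (q i) = G i (p i) (q i) :=
    fun i hi => by rw [Function.update_of_ne (Finset.ne_of_mem_erase hi)]
  simp only [alt]
  rw [← Finset.mul_prod_erase _ _ (Finset.mem_univ j),
    ← Finset.mul_prod_erase _ _ (Finset.mem_univ j),
    ← Finset.mul_prod_erase _ _ (Finset.mem_univ j), Finset.prod_congr rfl h1,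
    Finset.prod_congr rfl h2]
  simp only [Function.update_self]
  rw [smul_mul_assoc, mul_smul_comm]
  congr 1
  ring

/-- Alternation of a product of factors, the `j`-th of which depends only on `p_j` and `q_j`,
alternates each of the factors. -/
theorem foldr_alt_prod (c : S) (g : Fin n → Fin n → S) {l : List (Fin s)} (hl : l.Nodup) :
    l.foldr alt (fun p q : Fin s → Fin n => c * ∏ i, g (p i) (q i)) = fun p q =>
      c * ∏ i, (if i ∈ l then fun a b => (1 / 2 : ℝ) • (g a b - g b a) else g) (p i) (q i) := by
  classical
  induction l with
  | nil => simp
  | cons j l ih =>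
    rw [List.nodup_cons] at hl
    rw [List.foldr_cons, ih hl.2]
    funext p q
    rw [alt_prod]
    congr 1
    refine Finset.prod_congr rfl fun i _ => ?_
    rcases eq_or_ne i j with rfl | hij
    · simp [hl.1]
    · simp [hij]

end Alternation

section Symmetrization

variable {S : Type*} [CommRing S]

theorem sum_perm_prod_ite_eq {k : ℕ} (Z Y : Fin k → S) {s t : Finset (Fin k)}
    (h : s.card = t.card) :
    ∑ π : Equiv.Perm (Fin k), ∏ b, (if b ∈ s then Z (π b) else Y (π b)) =
      ∑ π : Equiv.Perm (Fin k), ∏ b, (if b ∈ t then Z (π b) else Y (π b)) := by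
  classical
  obtain ⟨τ, hτ⟩ : ∃ τ : Equiv.Perm (Fin k), ∀ b, τ b ∈ t ↔ b ∈ s := by
    have e : {b // b ∈ s} ≃ {b // b ∈ t} := Finset.equivOfCardEq h
    exact ⟨e.extendSubtype, fun b => ⟨fun hb => by
      by_contra hs
      exact e.extendSubtype_not_mem b hs hb, fun hb => e.extendSubtype_mem b hb⟩⟩
  rw [← Equiv.sum_comp (Equiv.mulRight τ)]
  refine Finset.sum_congr rfl fun π _ => ?_
  rw [← Equiv.prod_comp τ (fun b => if b ∈ t then Z (π b) else Y (π b))]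
  simp [hτ]

/-- The binomial expansion of `∏ (Y_a - Z_a)`, with the subsets of a given cardinality replaced by
the average over all permutations of one of them. -/
theorem sum_perm_sum_choose {k : ℕ} (Z Y : Fin k → S) :
    ∑ π : Equiv.Perm (Fin k), ∑ r : Fin (k + 1), ((-1) ^ (r : ℕ) * (k.choose r : S)) *
      ((∏ a : Fin r, Z (π (Fin.castLE (by omega) a))) *
        ∏ a : Fin (k - r), Y (π (Fin.cast (by omega) (Fin.natAdd (r : ℕ) a)))) =
      k.factorial • ∏ a, (Y a - Z a) := by
  classical
  set W : Finset (Fin k) → S := fun s =>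
    ∑ π : Equiv.Perm (Fin k), ∏ b, (if b ∈ s then Z (π b) else Y (π b)) with hW
  have h1 : ∀ r : Fin (k + 1), ∑ π : Equiv.Perm (Fin k), ((-1) ^ (r : ℕ) * (k.choose r : S)) *
      ((∏ a : Fin r, Z (π (Fin.castLE (by omega) a))) *
        ∏ a : Fin (k - r), Y (π (Fin.cast (by omega) (Fin.natAdd (r : ℕ) a)))) =
      ∑ s ∈ Finset.powersetCard r Finset.univ, (-1) ^ s.card * W s := by
    intro r
    have hr : (r : ℕ) + (k - r) = k := by omega
    set t : Finset (Fin k) := Finset.univ.filter fun b => (b : ℕ) < r with ht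
    have htc : t.card = r := by
      rw [ht, Fin.card_filter_val_lt]
      omega
    rw [Finset.sum_congr (s₁ := Finset.powersetCard r Finset.univ)
      (g := fun _ => (-1) ^ (r : ℕ) * W t) rfl, Finset.sum_const,
      Finset.card_powersetCard, Finset.card_univ, Fintype.card_fin, ← Finset.mul_sum, nsmul_eq_mul]
    · have : W t = ∑ π : Equiv.Perm (Fin k), (∏ a : Fin r, Z (π (Fin.castLE (by omega) a))) *
          ∏ a : Fin (k - r), Y (π (Fin.cast (by omega) (Fin.natAdd (r : ℕ) a))) := by
        refine Finset.sum_congr rfl fun π _ => ?_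
        rw [← (finCongr hr).prod_comp, Fin.prod_univ_add]
        congr 1
        · exact Finset.prod_congr rfl fun a _ => by
            rw [if_pos (by simp [ht])]; rfl
        · exact Finset.prod_congr rfl fun a _ => by
            rw [if_neg (by simp [ht])]; rfl
      rw [this]
      ring
    · intro s hs
      have hs' := (Finset.mem_powersetCard.1 hs).2
      rw [hs']
      congr 1
      exact sum_perm_prod_ite_eq Z Y (hs'.trans htc.symm)
  rw [Finset.sum_comm, Finset.sum_congr rfl fun r _ => h1 r,
    Fin.sum_univ_eq_sum_range fun r =>
      ∑ s ∈ Finset.powersetCard r (Finset.univ : Finset (Fin k)), (-1) ^ s.card * W s]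
  have h2 := Finset.sum_powerset (Finset.univ : Finset (Fin k)) fun s => (-1) ^ s.card * W s
  rw [Finset.card_univ, Fintype.card_fin] at h2
  rw [← h2]
  simp only [hW, Finset.mul_sum]
  rw [Finset.sum_comm]
  have h3 : ∀ π : Equiv.Perm (Fin k), ∑ s ∈ (Finset.univ : Finset (Fin k)).powerset,
      (-1) ^ s.card * ∏ b, (if b ∈ s then Z (π b) else Y (π b)) = ∏ a, (Y a - Z a) := by
    intro π
    rw [← Equiv.prod_comp π, Finset.prod_congr rfl fun a _ => sub_eq_neg_add _ _, Finset.prod_add]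
    refine Finset.sum_congr rfl fun s _ => ?_
    rw [Finset.prod_neg, mul_assoc, Finset.prod_ite, Finset.filter_mem_eq_inter,
      Finset.univ_inter, Finset.filter_notMem_eq_sdiff]
  rw [Finset.sum_congr rfl fun π _ => h3 π, Finset.sum_const, Finset.card_univ, Fintype.card_perm,
    Fintype.card_fin]

end Symmetrization

end TensorField

/-- Symbols of constant coefficient bidifferential operators `(F, h) ↦ P(D ⊗ 1, 1 ⊗ D)(F ⊗ h)`
restricted to the diagonal: `X (inl a)` stands for `∂_a` acting on `F`, `X (inr a)` for `∂_a` acting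
on `h`. -/
abbrev Symb (n : ℕ) := MvPolynomial (Fin n ⊕ Fin n) ℝ

/-- The Leibniz rule: `∂_a` acts on the product `F h` as `D_a ⊗ 1 + 1 ⊗ D_a`. -/
instance Symb.instLineDeriv (n : ℕ) : LineDeriv (Eucl n) (Symb n) (Symb n) where
  lineDerivOp v P := (∑ a, v a • (MvPolynomial.X (Sum.inl a) + MvPolynomial.X (Sum.inr a))) * P

namespace Symb

variable {n : ℕ}

/-- The symbol of `∂_{I_1} ⋯ ∂_{I_m}` acting on the first factor. -/
def left {m : ℕ} (I : Fin m → Fin n) : Symb n := ∏ j, MvPolynomial.X (Sum.inl (I j))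

/-- The symbol of `∂_{I_1} ⋯ ∂_{I_m}` acting on the second factor. -/
def right {m : ℕ} (I : Fin m → Fin n) : Symb n := ∏ j, MvPolynomial.X (Sum.inr (I j))

theorem lineDeriv_basisVec (a : Fin n) (P : Symb n) : ∂_{basisVec a} P =
    (MvPolynomial.X (Sum.inl a) + MvPolynomial.X (Sum.inr a)) * P := by
  change (∑ b, (basisVec a : Eucl n) b • _) * P = _
  congr 1
  rw [Finset.sum_eq_single a] <;> simp +contextual

theorem iteratedLineDeriv_basisVec {r : ℕ} (i : Fin r → Fin n) (P : Symb n) :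
    ∂^{fun j => basisVec (i j)} P =
      (∏ j, (MvPolynomial.X (Sum.inl (i j)) + MvPolynomial.X (Sum.inr (i j)))) * P := by
  induction r with
  | zero => simp
  | succ r ih =>
    rw [LineDeriv.iteratedLineDerivOp_succ_left, lineDeriv_basisVec, Fin.prod_univ_succ, mul_assoc]
    exact congrArg _ (ih (Fin.tail i))

theorem R_mul_prod {s : ℕ} (c : Symb n) (g : Fin n → Symb n) (p q : Fin s → Fin n) :
    TensorField.R (fun P : Fin s → Fin n => c * ∏ j, g (P j)) p q =
      c * ∏ j, (1 / 2 : ℝ) • ((MvPolynomial.X (Sum.inl (q j)) + MvPolynomial.X (Sum.inr (q j))) *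
        g (p j) - (MvPolynomial.X (Sum.inl (p j)) + MvPolynomial.X (Sum.inr (p j))) * g (q j)) := by
  have h := TensorField.foldr_alt_prod c (fun a b : Fin n =>
    ((MvPolynomial.X (Sum.inl b) + MvPolynomial.X (Sum.inr b)) * g a : Symb n))
    (List.nodup_finRange s)
  unfold TensorField.R
  simp only [iteratedLineDeriv_basisVec]
  convert congrFun (congrFun h p) q using 1
  · refine congrFun (congrFun (congrArg (fun U => List.foldr TensorField.alt U (List.finRange s))
      (funext fun p => funext fun q => ?_)) p) q
    rw [Finset.prod_mul_distrib]
    ring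
  · simp

/-- The identity between symbols: with `∂^I` acting on the second factor in place of the fields
`G_{m-r}`, the alternating sum over `r` moves the `k` derivatives `∂_{i_1} ⋯ ∂_{i_k}` to the first
factor, and each of the `m - k` alternations moves one more. -/
theorem sum_symm_R_right {m k : ℕ} (hk : k ≤ m) (p q : Fin (m - k) → Fin n) (i : Fin k → Fin n) :
    TensorField.symm (fun i' : Fin k → Fin n =>
      ∑ r : Fin (k + 1), ((-1) ^ (r : ℕ) * (k.choose r : ℝ)) •
        ∂^{fun a : Fin r => basisVec (i' (Fin.castLE (by omega) a))}
          (TensorField.Rgen (k := k - r) (by omega)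
            (right : TensorField (Symb n) n (m - r)) p q
            (fun a => i' (Fin.cast (by omega) (Fin.natAdd (r : ℕ) a))))) i =
      (-1 : ℝ) ^ m • (TensorField.fixIdx (Nat.sub_add_cancel hk) left i).R p q := by
  have hfix : ∀ (e : Fin n → Fin n ⊕ Fin n) {s t w : ℕ} (h : s + t = w) (j : Fin t → Fin n),
      TensorField.fixIdx h (fun I : Fin w → Fin n => ∏ b, (MvPolynomial.X (e (I b)) : Symb n)) j =
      fun P => (∏ b, MvPolynomial.X (e (j b))) * ∏ b, MvPolynomial.X (e (P b)) := by
    intro e s t w h j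
    subst h
    funext P
    change ∏ b, MvPolynomial.X (e (Fin.append P j b)) = _
    rw [Fin.prod_univ_add, mul_comm]
    simp
  have hl : TensorField.fixIdx (Nat.sub_add_cancel hk) left i = fun P =>
      (∏ b, MvPolynomial.X (Sum.inl (i b))) * ∏ b, (MvPolynomial.X (Sum.inl (P b)) : Symb n) :=
    hfix Sum.inl _ i
  set Q : Symb n := ∏ j, (1 / 2 : ℝ) •
    ((MvPolynomial.X (Sum.inl (q j)) + MvPolynomial.X (Sum.inr (q j))) *
        MvPolynomial.X (Sum.inr (p j)) -
      (MvPolynomial.X (Sum.inl (p j)) + MvPolynomial.X (Sum.inr (p j))) *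
        MvPolynomial.X (Sum.inr (q j))) with hQ
  have hr : ∀ (r : Fin (k + 1)) (j : Fin (k - r) → Fin n),
      TensorField.Rgen (k := k - r) (by omega) (right : TensorField (Symb n) n (m - r)) p q j =
        (∏ b, MvPolynomial.X (Sum.inr (j b))) * Q := by
    intro r j
    have h1 : TensorField.fixIdx (s := m - k) (by omega)
        (right : TensorField (Symb n) n (m - r)) j = fun P =>
        (∏ b, MvPolynomial.X (Sum.inr (j b))) * ∏ b, (MvPolynomial.X (Sum.inr (P b)) : Symb n) :=
      hfix Sum.inr _ j
    rw [TensorField.Rgen, h1]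
    exact R_mul_prod _ (fun a => MvPolynomial.X (Sum.inr a)) p q
  have hR : (TensorField.fixIdx (Nat.sub_add_cancel hk) left i).R p q =
      (∏ b, MvPolynomial.X (Sum.inl (i b))) * ((-1) ^ (m - k) * Q) := by
    rw [hl]
    refine (R_mul_prod _ (fun a => MvPolynomial.X (Sum.inl a)) p q).trans ?_
    have hc : ((-1 : Symb n)) ^ (m - k) = ∏ _j : Fin (m - k), -1 := by simp
    rw [hQ, hc, ← Finset.prod_mul_distrib]
    congr 1
    refine Finset.prod_congr rfl fun j _ => ?_
    rw [neg_one_mul, ← smul_neg]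
    congr 1
    ring
  have key := TensorField.sum_perm_sum_choose
    (fun a => (MvPolynomial.X (Sum.inl (i a)) + MvPolynomial.X (Sum.inr (i a)) : Symb n))
    (fun a => MvPolynomial.X (Sum.inr (i a)))
  have hk0 : (k.factorial : ℝ) ≠ 0 := by exact_mod_cast k.factorial_ne_zero
  rw [hR, TensorField.symm, inv_smul_eq_iff₀ hk0]
  simp only [iteratedLineDeriv_basisVec, hr]
  calc _ = (∑ π : Equiv.Perm (Fin k), ∑ r : Fin (k + 1),
        ((-1) ^ (r : ℕ) * (k.choose r : Symb n)) *
        ((∏ a : Fin r, (MvPolynomial.X (Sum.inl (i (π (Fin.castLE (by omega) a)))) +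
            MvPolynomial.X (Sum.inr (i (π (Fin.castLE (by omega) a)))))) *
          ∏ a : Fin (k - r),
            MvPolynomial.X (Sum.inr (i (π (Fin.cast (by omega) (Fin.natAdd (r : ℕ) a))))))) * Q := by
        rw [Finset.sum_mul]
        refine Finset.sum_congr rfl fun π _ => ?_
        rw [Finset.sum_mul]
        refine Finset.sum_congr rfl fun r _ => ?_
        rw [Algebra.smul_def]
        simp only [map_mul, map_pow, map_neg, map_one, map_natCast, Function.comp_apply]
        ring
    _ = _ := by
        rw [key]
        have hX : ∀ a : Fin k, (MvPolynomial.X (Sum.inr (i a)) -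
            (MvPolynomial.X (Sum.inl (i a)) + MvPolynomial.X (Sum.inr (i a))) : Symb n) =
            -1 * MvPolynomial.X (Sum.inl (i a)) := fun a => by ring
        have hm : (-1 : Symb n) ^ m = (-1) ^ (m - k) * (-1) ^ k := by
          rw [← pow_add, Nat.sub_add_cancel hk]
        have h1 : (-1 : Symb n) ^ (m - k) * (-1) ^ (m - k) = 1 := by
          rw [← mul_pow]; simp
        simp only [hX, Finset.prod_mul_distrib, Finset.prod_const, Finset.card_univ,
          Fintype.card_fin]
        rw [nsmul_eq_mul, Algebra.smul_def, Algebra.smul_def]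
        simp only [map_pow, map_neg, map_one, map_natCast]
        rw [hm]
        linear_combination (-(k.factorial : Symb n) * (-1) ^ k *
          (∏ b, MvPolynomial.X (Sum.inl (i b))) * Q) * h1

end Symb

/-! ### Differential operators with constant coefficients on smooth functions -/

section Commuting

variable {σ M : Type*} [AddCommMonoid M] [Module ℝ M]

open scoped IsMulCommutative in
theorem exists_algHom_of_commute (D : σ → Module.End ℝ M) (hD : ∀ a b, Commute (D a) (D b)) :
    ∃ Λ : MvPolynomial σ ℝ →ₐ[ℝ] Module.End ℝ M, ∀ a, Λ (MvPolynomial.X a) = D a := by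
  have := Algebra.isMulCommutative_adjoin ℝ (s := Set.range D) (by
    rintro _ ⟨a, rfl⟩ _ ⟨b, rfl⟩
    exact hD a b)
  refine ⟨(Algebra.adjoin ℝ (Set.range D)).val.comp
    (MvPolynomial.aeval fun a => ⟨D a, Algebra.subset_adjoin ⟨a, rfl⟩⟩), fun a => ?_⟩
  simp

/-- Evaluation of a polynomial at a family of commuting endomorphisms. -/
def evalCommuting (D : σ → Module.End ℝ M) (hD : ∀ a b, Commute (D a) (D b)) :
    MvPolynomial σ ℝ →ₐ[ℝ] Module.End ℝ M :=
  (exists_algHom_of_commute D hD).choose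

theorem evalCommuting_X (D : σ → Module.End ℝ M) (hD : ∀ a b, Commute (D a) (D b)) (a : σ) :
    evalCommuting D hD (MvPolynomial.X a) = D a :=
  (exists_algHom_of_commute D hD).choose_spec a

end Commuting

namespace SmoothFun

variable {n : ℕ}

theorem dirDeriv_apply (v : Eucl n) (F : SmoothFun n) (x : Eucl n) :
    (dirDeriv v F : Eucl n → ℝ) x = fderiv ℝ (F : Eucl n → ℝ) x v := rfl

theorem differentiable_coe (F : SmoothFun n) : Differentiable ℝ (F : Eucl n → ℝ) :=
  (contDiff_coe F).differentiable (by simp)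

theorem commute_dirDeriv (v w : Eucl n) :
    Commute (dirDeriv v : Module.End ℝ (SmoothFun n)) (dirDeriv w) := by
  refine LinearMap.ext fun F => Subtype.ext (funext fun x => ?_)
  change fderiv ℝ (fun y => fderiv ℝ (F : Eucl n → ℝ) y w) x v =
    fderiv ℝ (fun y => fderiv ℝ (F : Eucl n → ℝ) y v) x w
  have hd : DifferentiableAt ℝ (fderiv ℝ (F : Eucl n → ℝ)) x :=
    (((contDiff_coe F).fderiv_right (m := ∞) le_rfl).differentiable (by simp)) x
  have hs : IsSymmSndFDerivAt ℝ (F : Eucl n → ℝ) x :=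
    (contDiff_coe F).contDiffAt.isSymmSndFDerivAt (by
      rw [minSmoothness_of_isRCLikeNormedField]; exact WithTop.coe_le_coe.2 le_top)
  rw [fderiv_clm_apply hd (differentiableAt_const _),
    fderiv_clm_apply hd (differentiableAt_const _)]
  simpa using hs v w

/-- The product of smooth functions. -/
def mul : SmoothFun n →ₗ[ℝ] SmoothFun n →ₗ[ℝ] SmoothFun n :=
  LinearMap.mk₂ ℝ
    (fun F h => ⟨fun x => (F : Eucl n → ℝ) x * (h : Eucl n → ℝ) x,
      (contDiff_coe F).mul (contDiff_coe h)⟩)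
    (fun F G h => Subtype.ext (funext fun x => by simp [add_mul]))
    (fun c F h => Subtype.ext (funext fun x => by simp [mul_assoc]))
    (fun F g h => Subtype.ext (funext fun x => by simp [mul_add]))
    (fun c F h => Subtype.ext (funext fun x => by simp [mul_left_comm]))

theorem mul_apply (F h : SmoothFun n) (x : Eucl n) :
    (mul F h : Eucl n → ℝ) x = (F : Eucl n → ℝ) x * (h : Eucl n → ℝ) x := rfl

theorem dirDeriv_mul (v : Eucl n) (F h : SmoothFun n) :
    dirDeriv v (mul F h) = mul (dirDeriv v F) h + mul F (dirDeriv v h) := by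
  refine Subtype.ext (funext fun x => ?_)
  change fderiv ℝ (fun y => (F : Eucl n → ℝ) y * (h : Eucl n → ℝ) y) x v = _ + _
  rw [fderiv_fun_mul (differentiable_coe F x) (differentiable_coe h x)]
  simp only [mul_apply, dirDeriv_apply, FunLike.coe_add, Pi.add_apply, FunLike.coe_smul,
    Pi.smul_apply, smul_eq_mul]
  ring

/-- The differential operator with constant coefficients with a given symbol. -/
def diffOp (n : ℕ) : MvPolynomial (Fin n) ℝ →ₐ[ℝ] Module.End ℝ (SmoothFun n) :=
  evalCommuting (fun a => dirDeriv (basisVec a)) fun _ _ => commute_dirDeriv _ _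

theorem diffOp_X (a : Fin n) : diffOp n (MvPolynomial.X a) = dirDeriv (basisVec a) :=
  evalCommuting_X _ _ a

/-- The partial derivative `∂_{I_1} ⋯ ∂_{I_s} F`. -/
def partials {s : ℕ} (I : Fin s → Fin n) (F : SmoothFun n) : SmoothFun n :=
  diffOp n (∏ j, MvPolynomial.X (I j)) F

theorem partials_comp_perm {s : ℕ} (π : Equiv.Perm (Fin s)) (I : Fin s → Fin n) (F : SmoothFun n) :
    partials (I ∘ π) F = partials I F := by
  unfold partials
  rw [← Equiv.prod_comp π (fun j => (MvPolynomial.X (I j) : MvPolynomial (Fin n) ℝ))]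
  rfl

theorem partials_apply {s : ℕ} (I : Fin s → Fin n) (F : SmoothFun n) (x : Eucl n) :
    (partials I F : Eucl n → ℝ) x =
      iteratedFDeriv ℝ s (F : Eucl n → ℝ) x fun j => basisVec (I j) := by
  induction s generalizing x with
  | zero => simp [partials]
  | succ s ih =>
    have h1 : partials I F = dirDeriv (basisVec (I 0)) (partials (Fin.tail I) F) := by
      unfold partials
      rw [Fin.prod_univ_succ, map_mul, diffOp_X]
      rfl
    have h2 : (partials (Fin.tail I) F : Eucl n → ℝ) = fun x =>
        iteratedFDeriv ℝ s (F : Eucl n → ℝ) x fun j => basisVec (Fin.tail I j) :=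
      funext fun x => ih (Fin.tail I) x
    have h3 : DifferentiableAt ℝ (iteratedFDeriv ℝ s (F : Eucl n → ℝ)) x :=
      ((contDiff_coe F).differentiable_iteratedFDeriv (by exact_mod_cast WithTop.coe_lt_top s)) x
    rw [h1, dirDeriv_apply, h2, iteratedFDeriv_succ_apply_left,
      fderiv_continuousMultilinear_apply_const_apply h3]
    rfl

theorem dirDeriv_pow_eq_sum (ξ : Eucl n) (s : ℕ) (F : SmoothFun n) :
    ((dirDeriv ξ : Module.End ℝ (SmoothFun n)) ^ s) F =
      ∑ I : Fin s → Fin n, (∏ j, ξ (I j)) • partials I F := by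
  have h1 : (dirDeriv ξ : Module.End ℝ (SmoothFun n)) =
      diffOp n (∑ a, ξ a • MvPolynomial.X a) := by
    refine LinearMap.ext fun F => Subtype.ext (funext fun x => ?_)
    rw [map_sum, LinearMap.sum_apply, dirDeriv_apply]
    simp only [map_smul, diffOp_X, LinearMap.smul_apply, AddSubmonoidClass.coe_finsetSum,
      Finset.sum_apply, Submodule.coe_smul, Pi.smul_apply, dirDeriv_apply]
    conv_lhs => rw [← (EuclideanSpace.basisFun (Fin n) ℝ).sum_repr ξ]
    simp [map_sum]
  rw [h1, ← map_pow, ← Fin.prod_const, Finset.prod_univ_sum, map_sum, LinearMap.sum_apply]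
  simp only [Fintype.piFinset_univ]
  refine Finset.sum_congr rfl fun I _ => ?_
  rw [Finset.prod_smul, map_smul]
  rfl

theorem monomialFun_apply {b : ℕ} (J : Fin b → Fin n) (x : Eucl n) :
    (monomialFun J : Eucl n → ℝ) x = ∏ j, x (J j) := rfl

/-- The full derivatives of a monomial: `∂_{I_1} ⋯ ∂_{I_m} (z_{J_1} ⋯ z_{J_m})` is the number of
permutations that carry `I` to `J`. -/
theorem partials_monomialFun {m : ℕ} (I J : Fin m → Fin n) (x : Eucl n) :
    (partials I (monomialFun J) : Eucl n → ℝ) x =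
      ∑ π : Equiv.Perm (Fin m), if I ∘ π = J then 1 else 0 := by
  have h1 : (monomialFun J : Eucl n → ℝ) = fun x =>
      ((ContinuousMultilinearMap.mkPiAlgebra ℝ (Fin m) ℝ).compContinuousLinearMap
        fun j => (EuclideanSpace.proj (J j) : Eucl n →L[ℝ] ℝ)) fun _ => x := by
    funext x
    simp [monomialFun_apply]
  rw [partials_apply, h1, ContinuousMultilinearMap.iteratedFDeriv_comp_diagonal]
  refine Finset.sum_congr rfl fun π _ => ?_
  simp only [ContinuousMultilinearMap.compContinuousLinearMap_apply,
    ContinuousMultilinearMap.mkPiAlgebra_apply, EuclideanSpace.coe_proj, basisVec,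
    PiLp.single_apply]
  rw [Finset.prod_ite_zero]
  simp [funext_iff, eq_comm]

/-- Polarization: a symmetric tensor vanishes if its contractions with all `ξ^{⊗ s}` do. -/
theorem eq_zero_of_forall_sum_prod_eq_zero {s : ℕ} {U : TensorField ℝ n s} (hU : U.IsSymm)
    (h : ∀ ξ : Eucl n, ∑ J : Fin s → Fin n, (∏ j, ξ (J j)) * U J = 0) (I : Fin s → Fin n) :
    U I = 0 := by
  have h0 : ∑ J : Fin s → Fin n, U J • monomialFun J = (0 : SmoothFun n) := by
    refine Subtype.ext (funext fun ξ => ?_)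
    simpa [monomialFun_apply, mul_comm] using h ξ
  have h1 : ∑ J : Fin s → Fin n, U J * (partials I (monomialFun J) : Eucl n → ℝ) 0 = 0 := by
    have h2 := congrArg (fun F => (partials I F : Eucl n → ℝ) 0) h0
    simpa [partials] using h2
  simp only [partials_monomialFun, Finset.mul_sum] at h1
  rw [Finset.sum_comm] at h1
  simp only [mul_ite, mul_one, mul_zero, Finset.sum_ite_eq, Finset.mem_univ, if_true, hU _ I,
    Finset.sum_const, Finset.card_univ, Fintype.card_perm, Fintype.card_fin, nsmul_eq_mul] at h1
  exact (mul_eq_zero.1 h1).resolve_left (by exact_mod_cast s.factorial_ne_zero)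

/-! ### Bidifferential operators -/

/-- The operators `∂_a ⊗ 1` and `1 ⊗ ∂_a`. -/
def tensorDeriv (a : Fin n ⊕ Fin n) :
    Module.End ℝ (TensorProduct ℝ (SmoothFun n) (SmoothFun n)) :=
  a.elim (fun a => (dirDeriv (basisVec a)).rTensor _) fun a => (dirDeriv (basisVec a)).lTensor _

theorem commute_tensorDeriv (a b : Fin n ⊕ Fin n) :
    Commute (tensorDeriv a) (tensorDeriv b) := by
  rcases a with a | a <;> rcases b with b | b <;>
    refine TensorProduct.ext' fun F h => ?_
  · simpa [tensorDeriv] using congrArg (fun G => G ⊗ₜ[ℝ] h)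
      (LinearMap.congr_fun (commute_dirDeriv (basisVec a) (basisVec b)) F)
  · simp [tensorDeriv]
  · simp [tensorDeriv]
  · simpa [tensorDeriv] using congrArg (fun G => F ⊗ₜ[ℝ] G)
      (LinearMap.congr_fun (commute_dirDeriv (basisVec a) (basisVec b)) h)

/-- The value on `F` and `h` of the bidifferential operator with symbol `P`. -/
def bidiffOp (P : Symb n) (F h : SmoothFun n) : SmoothFun n :=
  TensorProduct.lift mul (evalCommuting tensorDeriv commute_tensorDeriv P (F ⊗ₜ[ℝ] h))

theorem bidiffOp_add (P Q : Symb n) (F h : SmoothFun n) :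
    bidiffOp (P + Q) F h = bidiffOp P F h + bidiffOp Q F h := by simp [bidiffOp]

theorem bidiffOp_smul (c : ℝ) (P : Symb n) (F h : SmoothFun n) :
    bidiffOp (c • P) F h = c • bidiffOp P F h := by simp [bidiffOp]

theorem bidiffOp_lineDeriv (a : Fin n) (P : Symb n) (F h : SmoothFun n) :
    bidiffOp (∂_{basisVec a} P) F h = dirDeriv (basisVec a) (bidiffOp P F h) := by
  have key : ∀ T : TensorProduct ℝ (SmoothFun n) (SmoothFun n),
      TensorProduct.lift mul ((tensorDeriv (Sum.inl a) + tensorDeriv (Sum.inr a)) T) =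
        dirDeriv (basisVec a) (TensorProduct.lift mul T) := by
    intro T
    induction T with
    | zero => simp
    | add T U hT hU => simp only [map_add, hT, hU]
    | tmul F h => simp [tensorDeriv, dirDeriv_mul]
  rw [Symb.lineDeriv_basisVec, bidiffOp, map_mul, map_add, evalCommuting_X, evalCommuting_X]
  exact key _

theorem bidiffOp_left {s : ℕ} (I : Fin s → Fin n) (F h : SmoothFun n) :
    bidiffOp (Symb.left I) F h = mul (partials I F) h := by
  have h1 : (evalCommuting tensorDeriv commute_tensorDeriv).comp (MvPolynomial.rename Sum.inl) =
      (Module.End.rTensorAlgHom ℝ (SmoothFun n) (SmoothFun n)).comp (diffOp n) := by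
    refine MvPolynomial.algHom_ext fun a => ?_
    simp only [AlgHom.comp_apply, MvPolynomial.rename_X, evalCommuting_X, diffOp_X]
    rfl
  have h2 := AlgHom.congr_fun h1 (∏ j, MvPolynomial.X (I j))
  have h3 : MvPolynomial.rename Sum.inl (∏ j, (MvPolynomial.X (I j) : MvPolynomial (Fin n) ℝ)) =
      ∏ j, (MvPolynomial.X (Sum.inl (I j)) : Symb n) := by
    rw [map_prod]
    simp only [MvPolynomial.rename_X]
  rw [AlgHom.comp_apply, h3] at h2
  rw [bidiffOp, Symb.left, h2]
  rfl

theorem bidiffOp_right {s : ℕ} (I : Fin s → Fin n) (F h : SmoothFun n) :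
    bidiffOp (Symb.right I) F h = mul F (partials I h) := by
  have h1 : (evalCommuting tensorDeriv commute_tensorDeriv).comp (MvPolynomial.rename Sum.inr) =
      (Module.End.lTensorAlgHom ℝ (SmoothFun n) (SmoothFun n)).comp (diffOp n) := by
    refine MvPolynomial.algHom_ext fun a => ?_
    simp only [AlgHom.comp_apply, MvPolynomial.rename_X, evalCommuting_X, diffOp_X]
    rfl
  have h2 := AlgHom.congr_fun h1 (∏ j, MvPolynomial.X (I j))
  have h3 : MvPolynomial.rename Sum.inr (∏ j, (MvPolynomial.X (I j) : MvPolynomial (Fin n) ℝ)) =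
      ∏ j, (MvPolynomial.X (Sum.inr (I j)) : Symb n) := by
    rw [map_prod]
    simp only [MvPolynomial.rename_X]
  rw [AlgHom.comp_apply, h3] at h2
  rw [bidiffOp, Symb.right, h2]
  rfl

end SmoothFun

/-! ### Derivatives of the regularized power `(|z|² + ε)^{-μ/2}` -/

/-- The coefficients of `∂_ξ^s |z|^{-μ}`. They extend the constants `c_{l,s}` to all exponents `μ`
and vanish for `2 l > s`. -/
def radialCoeff (μ : ℝ) (l s : ℕ) : ℝ :=
  (∏ w ∈ Finset.range (s - l), (μ + 2 * w)) *
    ((-1) ^ l * (s.descFactorial (2 * l) : ℝ) / (2 ^ l * l.factorial))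

theorem coeffC_eq_radialCoeff {n l s : ℕ} (h : 2 * l ≤ s) :
    coeffC n l s = radialCoeff ((n : ℝ) - 1) l s := by
  have h1 : ((s - 2 * l).factorial : ℝ) * (s.descFactorial (2 * l) : ℝ) = s.factorial := by
    exact_mod_cast Nat.factorial_mul_descFactorial h
  rw [coeffC, radialCoeff, ← h1]
  have : ((s - 2 * l).factorial : ℝ) ≠ 0 := by positivity
  field_simp

theorem radialCoeff_eq_zero (μ : ℝ) {l s : ℕ} (h : s < 2 * l) : radialCoeff μ l s = 0 := by
  simp [radialCoeff, Nat.descFactorial_eq_zero_iff_lt.2 h]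

theorem radialCoeff_zero_succ (μ : ℝ) (s : ℕ) :
    radialCoeff μ 0 (s + 1) = radialCoeff μ 0 s * (μ + 2 * s) := by
  simp [radialCoeff, Finset.prod_range_succ]

theorem radialCoeff_succ_succ (μ : ℝ) (l s : ℕ) :
    radialCoeff μ (l + 1) (s + 1) = radialCoeff μ (l + 1) s * (μ + 2 * ((s : ℝ) - (l + 1))) -
      radialCoeff μ l s * ((s : ℝ) - 2 * l) := by
  rcases lt_or_ge s (2 * l) with h | h
  · rw [radialCoeff_eq_zero μ h, radialCoeff_eq_zero μ (show s < 2 * (l + 1) by omega),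
      radialCoeff_eq_zero μ (show s + 1 < 2 * (l + 1) by omega)]
    ring
  have h1 : (((s + 1).descFactorial (2 * (l + 1)) : ℕ) : ℝ) =
      (s + 1) * ((s - 2 * l) * s.descFactorial (2 * l)) := by
    rw [show 2 * (l + 1) = 2 * l + 1 + 1 by ring, Nat.succ_descFactorial_succ,
      Nat.descFactorial_succ]
    push_cast [h]
    ring
  have h2 : ((s.descFactorial (2 * (l + 1)) : ℕ) : ℝ) =
      (s - 2 * l - 1) * ((s - 2 * l) * s.descFactorial (2 * l)) := by
    rw [show 2 * (l + 1) = 2 * l + 1 + 1 by ring, Nat.descFactorial_succ, Nat.descFactorial_succ]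
    rcases Nat.eq_or_lt_of_le h with h | h
    · simp [← h]
    · have : 2 * l + 1 ≤ s := h
      push_cast [this, h.le]
      ring
  have h3 : ((l + 1).factorial : ℝ) = (l + 1) * l.factorial := by
    rw [Nat.factorial_succ]; push_cast; ring
  rw [radialCoeff, radialCoeff, radialCoeff, h1, h2, h3, Nat.add_sub_add_right]
  have hl : (l.factorial : ℝ) ≠ 0 := by positivity
  rcases Nat.eq_or_lt_of_le (show l ≤ s by omega) with h4 | h4
  · obtain rfl : l = 0 := by omega
    obtain rfl : s = 0 := by omega
    simp
  · have h5 : s - l = s - (l + 1) + 1 := by omega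
    rw [h5, Finset.prod_range_succ, Nat.cast_sub (by omega : l + 1 ≤ s)]
    push_cast
    field_simp
    ring

namespace SmoothFun

variable {n : ℕ}

/-- The smooth regularization `(|z|² + ε)^{-μ/2}` of `|z|^{-μ}`. -/
def regPow (n : ℕ) (μ : ℝ) {ε : ℝ} (hε : 0 < ε) : SmoothFun n :=
  ⟨fun x => (‖x‖ ^ 2 + ε) ^ (-(μ / 2)),
    show ContDiff ℝ ∞ fun x : Eucl n => (‖x‖ ^ 2 + ε) ^ (-(μ / 2)) from
      ((contDiff_norm_sq ℝ).add contDiff_const).rpow_const_of_ne fun x => by positivity⟩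

theorem regPow_apply (μ : ℝ) {ε : ℝ} (hε : 0 < ε) (x : Eucl n) :
    (regPow n μ hε : Eucl n → ℝ) x = (‖x‖ ^ 2 + ε) ^ (-(μ / 2)) := rfl

open scoped RealInnerProductSpace

theorem hasDerivAt_radial_term (z ξ : Eucl n) (a : ℕ) (β : ℝ) {ε : ℝ} (hε : 0 < ε) :
    HasDerivAt (fun t : ℝ => ⟪ξ, z + t • ξ⟫ ^ a * (‖z + t • ξ‖ ^ 2 + ε) ^ (-β))
      (‖ξ‖ ^ 2 * (a * ⟪ξ, z⟫ ^ (a - 1) * (‖z‖ ^ 2 + ε) ^ (-β)) -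
        2 * β * (⟪ξ, z⟫ ^ (a + 1) * (‖z‖ ^ 2 + ε) ^ (-(β + 1)))) 0 := by
  have h1 : HasDerivAt (fun t : ℝ => z + t • ξ) ξ 0 := by
    simpa using ((hasDerivAt_id (0 : ℝ)).smul_const ξ).const_add z
  have h2 : HasDerivAt (fun t : ℝ => ⟪ξ, z + t • ξ⟫) (‖ξ‖ ^ 2) 0 := by
    have := (hasDerivAt_const (0 : ℝ) ξ).inner ℝ h1
    simpa using this
  have h3 : HasDerivAt (fun t : ℝ => ‖z + t • ξ‖ ^ 2 + ε) (2 * ⟪ξ, z⟫) 0 := by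
    have := h1.norm_sq.add_const ε
    simpa [real_inner_comm] using this
  have h4 : ‖z + (0 : ℝ) • ξ‖ ^ 2 + ε ≠ 0 := by positivity
  refine ((h2.fun_pow a).fun_mul (h3.rpow_const (p := -β) (Or.inl h4))).congr_deriv ?_
  simp only [zero_smul, add_zero]
  rw [show -β - 1 = -(β + 1) by ring]
  ring

/-- The powers of `∂_ξ` applied to `(|z|² + ε)^{-μ/2}`. -/
theorem dirDeriv_pow_regPow (μ : ℝ) {ε : ℝ} (hε : 0 < ε) (ξ : Eucl n) (s : ℕ) (z : Eucl n) :
    ((((dirDeriv ξ : Module.End ℝ (SmoothFun n)) ^ s) (regPow n μ hε) : SmoothFun n) :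
      Eucl n → ℝ) z = (-1) ^ s * ∑ l ∈ Finset.range (s + 1), radialCoeff μ l s *
        ((‖ξ‖ ^ 2) ^ l * (⟪ξ, z⟫ ^ (s - 2 * l) * (‖z‖ ^ 2 + ε) ^ (-(μ / 2 + s - l)))) := by
  induction s generalizing z with
  | zero => simp [radialCoeff, regPow_apply]
  | succ s ih =>
    rw [pow_succ', Module.End.mul_apply, dirDeriv_apply]
    have hg := differentiable_coe
      (((dirDeriv ξ : Module.End ℝ (SmoothFun n)) ^ s) (regPow n μ hε)) z
    rw [← hg.lineDeriv_eq_fderiv, lineDeriv]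
    simp only [ih]
    set B : ℕ → ℝ := fun l => (‖ξ‖ ^ 2) ^ l *
      (⟪ξ, z⟫ ^ (s + 1 - 2 * l) * (‖z‖ ^ 2 + ε) ^ (-(μ / 2 + (s + 1 : ℕ) - l))) with hB
    have hterm : ∀ l ∈ Finset.range (s + 1), HasDerivAt (fun t : ℝ => radialCoeff μ l s *
        ((‖ξ‖ ^ 2) ^ l * (⟪ξ, z + t • ξ⟫ ^ (s - 2 * l) *
          (‖z + t • ξ‖ ^ 2 + ε) ^ (-(μ / 2 + s - l)))))
        (radialCoeff μ l s * (((s : ℝ) - 2 * l) * B (l + 1)) -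
          radialCoeff μ l s * ((μ + 2 * ((s : ℝ) - l)) * B l)) 0 := by
      intro l _
      rcases lt_or_ge s (2 * l) with h | h
      · simpa [radialCoeff_eq_zero μ h] using hasDerivAt_const (0 : ℝ) (0 : ℝ)
      refine (((hasDerivAt_radial_term z ξ (s - 2 * l) (μ / 2 + s - l) hε).const_mul
        ((‖ξ‖ ^ 2) ^ l)).const_mul (radialCoeff μ l s)).congr_deriv ?_
      simp only [hB]
      rw [show s + 1 - 2 * (l + 1) = s - 2 * l - 1 by omega,
        show s + 1 - 2 * l = s - 2 * l + 1 by omega, Nat.cast_sub h]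
      push_cast
      rw [show -(μ / 2 + ((s : ℝ) + 1) - ((l : ℝ) + 1)) = -(μ / 2 + s - l) by ring,
        show -(μ / 2 + ((s : ℝ) + 1) - (l : ℝ)) = -(μ / 2 + s - l + 1) by ring]
      ring
    rw [((HasDerivAt.fun_sum hterm).const_mul ((-1 : ℝ) ^ s)).deriv, Finset.sum_sub_distrib,
      Finset.sum_range_succ' (fun l => radialCoeff μ l (s + 1) * B l) (s + 1)]
    have h0 : ∑ l ∈ Finset.range (s + 1), radialCoeff μ l s * ((μ + 2 * ((s : ℝ) - l)) * B l) =
        ∑ l ∈ Finset.range (s + 1), radialCoeff μ (l + 1) s *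
          ((μ + 2 * ((s : ℝ) - (l + 1))) * B (l + 1)) +
            radialCoeff μ 0 s * ((μ + 2 * s) * B 0) := by
      rw [Finset.sum_range_succ', Finset.sum_range_succ _ s,
        radialCoeff_eq_zero μ (show s < 2 * (s + 1) by omega)]
      simp
    rw [h0, radialCoeff_zero_succ]
    simp only [radialCoeff_succ_succ, sub_mul, Finset.sum_sub_distrib, mul_assoc, pow_succ]
    ring

end SmoothFun

namespace TensorField

variable {n : ℕ}

open scoped RealInnerProductSpace

/-- The tensor `z^{⊗ s}`. -/
def tpow (s : ℕ) (z : Eucl n) : TensorField ℝ n s := fun I => ∏ j, z (I j)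

/-- The tensor `i^l z^{⊗ (s - 2 l)}` of rank `s`. -/
def metricPart {s : ℕ} (l : ℕ) (hl : 2 * l ≤ s) (z : Eucl n) : TensorField ℝ n s :=
  cast (Nat.sub_add_cancel hl) (metricMulPow l (tpow (s - 2 * l) z))

theorem metricContractPow_tpow {s : ℕ} (l : ℕ) (z : Eucl n) :
    metricContractPow l (tpow (s + 2 * l) z) = fun I => (‖z‖ ^ 2) ^ l * tpow s z I := by
  induction l with
  | zero =>
    funext I
    simp only [pow_zero, one_mul]
    rfl
  | succ l ih =>
    have hlin : ∀ (c : ℝ) {m : ℕ} (u : TensorField ℝ n (m + 2 * l)) (I : Fin m → Fin n),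
        metricContractPow l (fun J => c * u J) I = c * metricContractPow l u I := by
      intro c m u I
      have hrel : IsLinearRel fun a b : ℝ => a = c * b :=
        ⟨by simp, fun h h' => by rw [h, h']; ring, fun d a b h => by
          simp only [smul_eq_mul, h]; ring⟩
      exact hrel.metricContractPow l (fun J => rfl) I
    have h1 : metricContract (tpow (s + 2 * l + 2) z) =
        fun I => ‖z‖ ^ 2 * tpow (s + 2 * l) z I := by
      funext I
      simp only [metricContract, tpow]
      rw [EuclideanSpace.real_norm_sq_eq, Finset.sum_mul]
      refine Finset.sum_congr rfl fun a _ => ?_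
      rw [Fin.prod_univ_castSucc, Fin.prod_univ_castSucc]
      simp only [Fin.snoc_castSucc, Fin.snoc_last]
      ring
    funext I
    change metricContractPow l (metricContract (tpow (s + 2 * l + 2) z)) I = _
    rw [h1, hlin, ih, pow_succ]
    ring

theorem mulContract_tpow {s : ℕ} (l : ℕ) (hl : 2 * l ≤ s) (z : Eucl n) (I : Fin s → Fin n) :
    mulContract l hl (tpow s z) I = (‖z‖ ^ 2) ^ l * metricPart l hl z I := by
  have h1 : cast (Nat.sub_add_cancel hl).symm (tpow s z) = tpow (s - 2 * l + 2 * l) z := by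
    funext J
    exact (finCongr (Nat.sub_add_cancel hl).symm).prod_comp fun b => z (J b)
  have hrel : IsLinearRel fun a b : ℝ => a = (‖z‖ ^ 2) ^ l * b :=
    ⟨by simp, fun h h' => by rw [h, h']; ring, fun d a b h => by
      simp only [smul_eq_mul, h]; ring⟩
  rw [mulContract, h1, metricContractPow_tpow]
  exact hrel.metricMulPow l (fun J => rfl) _

theorem isSymm_symm {A : Type*} [AddCommGroup A] [Module ℝ A] {m : ℕ} (u : TensorField A n m) :
    (symm u).IsSymm := by
  intro π I
  unfold symm
  conv_rhs => rw [← Equiv.sum_comp (Equiv.mulLeft π)]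
  rfl

theorem isSymm_metricMul {A : Type*} [AddCommGroup A] [Module ℝ A] {m : ℕ}
    (u : TensorField A n m) : (metricMul u).IsSymm :=
  isSymm_symm _

theorem isSymm_tpow (s : ℕ) (z : Eucl n) : (tpow s z).IsSymm :=
  fun π I => Equiv.prod_comp π fun j => z (I j)

theorem IsSymm.cast {A : Type*} {a b : ℕ} (h : a = b) {u : TensorField A n a} (hu : u.IsSymm) :
    (TensorField.cast h u).IsSymm := by
  subst h
  exact hu

theorem isSymm_metricPart {s : ℕ} (l : ℕ) (hl : 2 * l ≤ s) (z : Eucl n) :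
    (metricPart l hl z).IsSymm := by
  refine IsSymm.cast _ ?_
  cases l with
  | zero => exact isSymm_tpow _ z
  | succ l => exact isSymm_metricMul (metricMulPow l (tpow (s - 2 * (l + 1)) z))

theorem abs_symm_le {m : ℕ} {u : TensorField ℝ n m} {C : ℝ} (hu : ∀ I, |u I| ≤ C)
    (I : Fin m → Fin n) : |symm u I| ≤ C := by
  have hm : (0 : ℝ) < m.factorial := by positivity
  rw [symm, smul_eq_mul, abs_mul, abs_inv, abs_of_pos hm, inv_mul_le_iff₀ hm]
  refine (Finset.abs_sum_le_sum_abs _ _).trans ((Finset.sum_le_sum fun π _ => hu _).trans ?_)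
  simp [Fintype.card_perm]

theorem abs_metricMul_le {m : ℕ} {u : TensorField ℝ n m} {C : ℝ} (hC : 0 ≤ C)
    (hu : ∀ I, |u I| ≤ C) (I : Fin (m + 2) → Fin n) : |metricMul u I| ≤ C := by
  refine abs_symm_le (fun J => ?_) I
  split_ifs
  · exact hu _
  · simpa using hC

theorem continuous_metricMul {m : ℕ} {u : Eucl n → TensorField ℝ n m}
    (hu : ∀ I, Continuous fun z => u z I) (I : Fin (m + 2) → Fin n) :
    Continuous fun z => metricMul (u z) I := by
  refine continuous_const.mul (continuous_finsetSum _ fun π _ => ?_)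
  dsimp only
  split_ifs
  · exact hu _
  · exact continuous_const

theorem abs_metricPart_le {s : ℕ} (l : ℕ) (hl : 2 * l ≤ s) (z : Eucl n) (I : Fin s → Fin n) :
    |metricPart l hl z I| ≤ ‖z‖ ^ (s - 2 * l) := by
  have key : ∀ {m : ℕ} (l : ℕ) (J : Fin (m + 2 * l) → Fin n),
      |metricMulPow l (tpow m z) J| ≤ ‖z‖ ^ m := by
    intro m l
    induction l with
    | zero => exact fun J => abs_prod_coord_le J z
    | succ l ih =>
      exact abs_metricMul_le (by positivity) ih
  exact key l _

theorem continuous_metricPart {s : ℕ} (l : ℕ) (hl : 2 * l ≤ s) (I : Fin s → Fin n) :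
    Continuous fun z : Eucl n => metricPart l hl z I := by
  have key : ∀ {m : ℕ} (l : ℕ) (J : Fin (m + 2 * l) → Fin n),
      Continuous fun z : Eucl n => metricMulPow l (tpow m z) J := by
    intro m l
    induction l with
    | zero =>
      intro J
      change Continuous fun z : Eucl n => ∏ j, z (J j)
      fun_prop
    | succ l ih =>
      exact continuous_metricMul (u := fun z => metricMulPow l (tpow m z)) ih
  exact key l _

/-- The full contraction of a tensor with `ξ^{⊗ s}`. -/
def contractAll {s : ℕ} (ξ : Eucl n) (u : TensorField ℝ n s) : ℝ :=
  ∑ I : Fin s → Fin n, (∏ j, ξ (I j)) * u I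

theorem contractAll_cast {a b : ℕ} (h : a = b) (ξ : Eucl n) (u : TensorField ℝ n a) :
    contractAll ξ (cast h u) = contractAll ξ u := by
  subst h
  rfl

theorem contractAll_symm {s : ℕ} (ξ : Eucl n) (u : TensorField ℝ n s) :
    contractAll ξ (symm u) = contractAll ξ u := by
  have hs : (s.factorial : ℝ) ≠ 0 := by positivity
  simp only [contractAll, symm, smul_eq_mul, Finset.mul_sum]
  rw [Finset.sum_comm]
  have h1 : ∀ π : Equiv.Perm (Fin s), ∑ I : Fin s → Fin n,
      (∏ j, ξ (I j)) * ((s.factorial : ℝ)⁻¹ * u (I ∘ π)) =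
        (s.factorial : ℝ)⁻¹ * contractAll ξ u := by
    intro π
    rw [contractAll, Finset.mul_sum,
      ← Equiv.sum_comp (Equiv.arrowCongr π.symm (Equiv.refl (Fin n)))
        (fun I => (s.factorial : ℝ)⁻¹ * ((∏ j, ξ (I j)) * u I))]
    refine Finset.sum_congr rfl fun I _ => ?_
    have h2 : (Equiv.arrowCongr π.symm (Equiv.refl (Fin n))) I = I ∘ π := by
      funext j; simp [Equiv.arrowCongr]
    rw [h2, ← Equiv.prod_comp π fun j => ξ (I j)]
    simp only [Function.comp_apply]
    ring
  rw [Finset.sum_congr rfl fun π _ => h1 π, Finset.sum_const, Finset.card_univ, Fintype.card_perm,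
    Fintype.card_fin, nsmul_eq_mul, mul_inv_cancel_left₀ hs]
  rfl

theorem contractAll_metricMul {s : ℕ} (ξ : Eucl n) (u : TensorField ℝ n s) :
    contractAll ξ (metricMul u) = ‖ξ‖ ^ 2 * contractAll ξ u := by
  rw [metricMul, contractAll_symm, contractAll,
    ← (Fin.consEquiv fun _ : Fin (s + 2) => Fin n).sum_comp, Fintype.sum_prod_type]
  simp only [← (Fin.consEquiv fun _ : Fin (s + 1) => Fin n).sum_comp, Fintype.sum_prod_type]
  rw [EuclideanSpace.real_norm_sq_eq, Finset.sum_mul]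
  refine Finset.sum_congr rfl fun a _ => ?_
  rw [Finset.sum_eq_single a]
  · rw [contractAll, Finset.mul_sum]
    refine Finset.sum_congr rfl fun I _ => ?_
    simp [Fin.consEquiv, Fin.prod_univ_succ]
    ring
  · intro b _ hb
    refine Finset.sum_eq_zero fun I _ => ?_
    have : ¬ a = b := fun h => hb h.symm
    simp [Fin.consEquiv, this]
  · simp

theorem contractAll_tpow (s : ℕ) (ξ z : Eucl n) : contractAll ξ (tpow s z) = ⟪ξ, z⟫ ^ s := by
  rw [PiLp.inner_apply, ← Fin.prod_const, Finset.prod_univ_sum, contractAll]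
  simp only [Fintype.piFinset_univ]
  refine Finset.sum_congr rfl fun I _ => ?_
  rw [tpow, ← Finset.prod_mul_distrib]
  refine Finset.prod_congr rfl fun j _ => ?_
  simp [mul_comm]

theorem contractAll_metricPart {s : ℕ} (l : ℕ) (hl : 2 * l ≤ s) (ξ z : Eucl n) :
    contractAll ξ (metricPart l hl z) = (‖ξ‖ ^ 2) ^ l * ⟪ξ, z⟫ ^ (s - 2 * l) := by
  rw [metricPart, contractAll_cast]
  generalize s - 2 * l = m
  induction l with
  | zero =>
    rw [pow_zero, one_mul]
    exact contractAll_tpow m ξ z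
  | succ l ih =>
    change contractAll ξ (metricMul (metricMulPow l (tpow m z))) = _
    rw [contractAll_metricMul, ih (by omega), pow_succ]
    ring

/-- The partial derivatives of `(|z|² + ε)^{-(n-1)/2}`. At `ε = 0` the sum on the right is the one
defining `G_s`. -/
theorem partials_regPow {s : ℕ} {ε : ℝ} (hε : 0 < ε) (I : Fin s → Fin n) (z : Eucl n) :
    (SmoothFun.partials I (SmoothFun.regPow n ((n : ℝ) - 1) hε) : Eucl n → ℝ) z =
      (-1) ^ s * ∑ l : Fin (s / 2 + 1), coeffC n l s * (metricPart (l : ℕ) (by omega) z I *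
        (‖z‖ ^ 2 + ε) ^ (-(((n : ℝ) - 1) / 2 + s - (l : ℕ)))) := by
  set h := SmoothFun.regPow n ((n : ℝ) - 1) hε
  set V : TensorField ℝ n s := fun I => (-1) ^ s * ∑ l : Fin (s / 2 + 1), coeffC n l s *
    (metricPart (l : ℕ) (by omega) z I *
      (‖z‖ ^ 2 + ε) ^ (-(((n : ℝ) - 1) / 2 + s - (l : ℕ)))) with hV
  have hsymm : IsSymm (fun I : Fin s → Fin n => (SmoothFun.partials I h : Eucl n → ℝ) z - V I) := by
    intro π I
    simp only [hV, SmoothFun.partials_comp_perm, isSymm_metricPart _ _ z π I]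
  refine sub_eq_zero.1 (SmoothFun.eq_zero_of_forall_sum_prod_eq_zero hsymm (fun ξ => ?_) I)
  have h1 := congrArg (fun F : SmoothFun n => (F : Eucl n → ℝ) z)
    (SmoothFun.dirDeriv_pow_eq_sum ξ s h)
  simp only [AddSubmonoidClass.coe_finsetSum, Finset.sum_apply, Submodule.coe_smul, Pi.smul_apply,
    smul_eq_mul] at h1
  simp only [mul_sub, Finset.sum_sub_distrib]
  rw [← h1, SmoothFun.dirDeriv_pow_regPow, sub_eq_zero]
  have h2 : ∑ J : Fin s → Fin n, (∏ j, ξ (J j)) * V J = (-1) ^ s * ∑ l : Fin (s / 2 + 1),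
      coeffC n l s * (contractAll ξ (metricPart (s := s) (l : ℕ) (by omega) z) *
        (‖z‖ ^ 2 + ε) ^ (-(((n : ℝ) - 1) / 2 + s - (l : ℕ)))) := by
    simp only [hV, contractAll, Finset.mul_sum, Finset.sum_mul]
    rw [Finset.sum_comm]
    refine Finset.sum_congr rfl fun l _ => Finset.sum_congr rfl fun J _ => ?_
    ring
  rw [h2]
  congr 1
  rw [← Finset.sum_subset (Finset.range_subset_range.2 (show s / 2 + 1 ≤ s + 1 by omega)),
    ← Fin.sum_univ_eq_sum_range (fun l => radialCoeff ((n : ℝ) - 1) l s * ((‖ξ‖ ^ 2) ^ l *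
      (⟪ξ, z⟫ ^ (s - 2 * l) * (‖z‖ ^ 2 + ε) ^ (-(((n : ℝ) - 1) / 2 + s - l)))))]
  · refine Finset.sum_congr rfl fun l _ => ?_
    rw [contractAll_metricPart, coeffC_eq_radialCoeff (by omega)]
    ring
  · intro l _ hl
    rw [Finset.mem_range] at hl
    rw [radialCoeff_eq_zero _ (by omega), zero_mul]

end TensorField

/-! ### Integration along lines through the origin -/

open scoped RealInnerProductSpace

/-- If the weighted integrals of `Φ` over all lines through the origin vanish, so does its integral
over the space. Full lines, rather than half lines, are what makes integration by parts along the
line free of boundary terms at the origin. -/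
theorem integral_eq_zero_of_forall_line {n : ℕ} (hn : 0 < n) {Φ : Eucl n → ℝ} (hΦ : Integrable Φ)
    (hi : ∀ θ : Eucl n, ‖θ‖ = 1 → Integrable fun t : ℝ => |t| ^ (n - 1) * Φ (t • θ))
    (h0 : ∀ θ : Eucl n, ‖θ‖ = 1 → ∫ t : ℝ, |t| ^ (n - 1) * Φ (t • θ) = 0) :
    ∫ z, Φ z = 0 := by
  have : Nonempty (Fin n) := ⟨⟨0, hn⟩⟩
  set Ψ : Eucl n → ℝ := fun z => Φ z + Φ (-z) with hΨ
  have hΨi : Integrable Ψ := hΦ.add hΦ.comp_neg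
  have hsum : ∫ z, Ψ z = 2 * ∫ z, Φ z := by
    rw [hΨ, integral_add hΦ hΦ.comp_neg, integral_neg_eq_self]
    ring
  suffices h : ∫ z, Ψ z = 0 by linarith
  set μ : Measure (Eucl n) := volume
  have hmp := μ.measurePreserving_homeomorphUnitSphereProd
  set e := homeomorphUnitSphereProd (Eucl n)
  set g : Metric.sphere (0 : Eucl n) 1 × Set.Ioi (0 : ℝ) → ℝ := fun p => Ψ (p.2.1 • p.1.1) with hg
  have hge : ∀ x, g (e x) = Ψ x.1 := by
    intro x
    have h1 : ((e.symm (e x) : ({0}ᶜ : Set (Eucl n))) : Eucl n) = (e x).2.1 • (e x).1.1 := rfl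
    rw [e.symm_apply_apply] at h1
    rw [hg, h1]
  have h1 : ∫ z, Ψ z = ∫ x : ({0}ᶜ : Set (Eucl n)), Ψ x.1 ∂(μ.comap (↑)) := by
    rw [integral_subtype_comap (measurableSet_singleton _).compl fun x => Ψ x,
      restrict_compl_singleton]
  have h2 : ∫ x : ({0}ᶜ : Set (Eucl n)), Ψ x.1 ∂(μ.comap (↑)) =
      ∫ p, g p ∂(μ.toSphere.prod (.volumeIoiPow (Module.finrank ℝ (Eucl n) - 1))) := by
    rw [← hmp.integral_comp (Homeomorph.measurableEmbedding _)]
    simp only [hge]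
  have hgi : Integrable g (μ.toSphere.prod (.volumeIoiPow (Module.finrank ℝ (Eucl n) - 1))) := by
    rw [← hmp.integrable_comp_emb (Homeomorph.measurableEmbedding _)]
    have h3 : g ∘ e = fun x : ({0}ᶜ : Set (Eucl n)) => Ψ x.1 := funext hge
    rw [h3]
    have h4 : IntegrableOn Ψ ({0}ᶜ : Set (Eucl n)) μ := hΨi.integrableOn
    exact (integrableOn_iff_comap_subtypeVal (measurableSet_singleton _).compl).1 h4
  rw [h1, h2, integral_prod _ hgi]
  refine integral_eq_zero_of_ae (Filter.Eventually.of_forall fun θ => ?_)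
  have hθ : ‖(θ : Eucl n)‖ = 1 := by simp
  have h3 : ∫ x : Set.Ioi (0 : ℝ), g (θ, x) ∂(.volumeIoiPow (Module.finrank ℝ (Eucl n) - 1)) =
      ∫ t in Set.Ioi (0 : ℝ), t ^ (n - 1) * Ψ (t • (θ : Eucl n)) := by
    simp only [Measure.volumeIoiPow, ENNReal.ofReal]
    rw [integral_withDensity_eq_integral_smul
      ((measurable_subtype_coe.pow_const _).real_toNNReal),
      integral_subtype_comap measurableSet_Ioi fun a : ℝ =>
        Real.toNNReal (a ^ (Module.finrank ℝ (Eucl n) - 1)) • Ψ (a • (θ : Eucl n))]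
    refine setIntegral_congr_fun measurableSet_Ioi fun x hx => ?_
    rw [NNReal.smul_def, Real.coe_toNNReal _ (pow_nonneg (le_of_lt hx) _),
      finrank_euclideanSpace, Fintype.card_fin, smul_eq_mul]
  have h4 : ∫ t in Set.Ioi (0 : ℝ), t ^ (n - 1) * Ψ (t • (θ : Eucl n)) =
      (∫ t in Set.Ioi (0 : ℝ), |t| ^ (n - 1) * Φ (t • (θ : Eucl n))) +
        ∫ t in Set.Ioi (0 : ℝ), |-t| ^ (n - 1) * Φ ((-t) • (θ : Eucl n)) := by
    rw [← integral_add (hi _ hθ).integrableOn (hi _ hθ).comp_neg.integrableOn]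
    refine setIntegral_congr_fun measurableSet_Ioi fun x hx => ?_
    simp only [hΨ, abs_neg, abs_of_pos (show (0 : ℝ) < x from hx), neg_smul]
    ring
  refine h3.trans ?_
  rw [h4,
    integral_comp_neg_Ioi (0 : ℝ) (fun t => |t| ^ (n - 1) * Φ (t • (θ : Eucl n))), neg_zero,
    add_comm, intervalIntegral.integral_Iic_add_Ioi (hi _ hθ).integrableOn (hi _ hθ).integrableOn]
  exact h0 _ hθ

/-- Repeated integration by parts against the polynomial `(a + t)^p`. -/
theorem integral_pow_mul_iteratedDeriv (a : ℝ) (p : ℕ) {v : ℝ → ℝ} (hv : ContDiff ℝ ∞ v)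
    (hc : HasCompactSupport v) :
    ∫ t, (a + t) ^ p * iteratedDeriv p v t = (-1) ^ p * p.factorial * ∫ t, v t := by
  have hcs : ∀ p, HasCompactSupport (iteratedDeriv p v) := fun p => by
    induction p with
    | zero => simpa using hc
    | succ p ih => rw [iteratedDeriv_succ]; exact ih.deriv
  have hcont : ∀ p, Continuous (iteratedDeriv p v) := fun p =>
    hv.continuous_iteratedDeriv p (by exact_mod_cast le_top)
  have hint : ∀ (g : ℝ → ℝ) (p : ℕ), Continuous g → Integrable (g * iteratedDeriv p v) :=
    fun g p hg => (hg.mul (hcont p)).integrable_of_hasCompactSupport (hcs p).mul_left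
  induction p with
  | zero => simp
  | succ p ih =>
    have h1 : ∀ t : ℝ, HasDerivAt (fun t : ℝ => (a + t) ^ (p + 1)) ((p + 1) * (a + t) ^ p) t := by
      intro t
      have := ((hasDerivAt_id t).const_add a).fun_pow (p + 1)
      simpa using this
    have h2 : ∀ t : ℝ, HasDerivAt (iteratedDeriv p v) (iteratedDeriv (p + 1) v t) t := by
      intro t
      rw [iteratedDeriv_succ]
      exact ((hv.differentiable_iteratedDeriv p
        (by exact_mod_cast WithTop.coe_lt_top p)) t).hasDerivAt
    rw [integral_mul_deriv_eq_deriv_mul_of_integrable (fun t _ => h1 t) (fun t _ => h2 t)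
      (hint _ _ (by fun_prop)) (hint _ _ (by fun_prop)) (hint _ _ (by fun_prop))]
    simp only [mul_assoc]
    rw [integral_const_mul, ih, Nat.factorial_succ]
    push_cast
    ring

/-! ### Action of the operators on test functions -/

section Test

variable {n : ℕ}

theorem mulTest_apply (g : SmoothFun n) (φ : 𝓓((⊤ : Opens (Eucl n)), ℝ)) (x : Eucl n) :
    mulTest g φ x = φ x * (g : Eucl n → ℝ) x := rfl

theorem smoothMul_apply (g : SmoothFun n) (T : Distr n) (φ : 𝓓((⊤ : Opens (Eucl n)), ℝ)) :
    smoothMul g T φ = T (mulTest g φ) := rfl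

theorem conv_apply (T : CompactDistr n) {h : Eucl n → ℝ} (hh : LocallyIntegrable h)
    (φ : 𝓓((⊤ : Opens (Eucl n)), ℝ)) :
    conv T hh φ = (T : SmoothFun n →ₗ[ℝ] ℂ) (corrFun hh φ) := rfl

theorem corrFun_apply {h : Eucl n → ℝ} (hh : LocallyIntegrable h)
    (φ : 𝓓((⊤ : Opens (Eucl n)), ℝ)) (y : Eucl n) :
    (corrFun hh φ : Eucl n → ℝ) y = ∫ z, h z * φ (y + z) := by
  change ∫ x, h (x - y) * φ x = _
  rw [← integral_add_right_eq_self _ y]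
  simp only [add_comm _ y, add_sub_cancel_left]

theorem integrable_mul_test {h : Eucl n → ℝ} (hh : LocallyIntegrable h)
    (φ : 𝓓((⊤ : Opens (Eucl n)), ℝ)) (y : Eucl n) :
    Integrable fun z => h z * φ (y + z) := by
  have := (integrable_corr hh φ y).comp_add_right y
  simpa only [add_comm _ y, add_sub_cancel_left] using this

theorem testFunction_lineDeriv_apply (φ : 𝓓((⊤ : Opens (Eucl n)), ℝ)) (v x : Eucl n) :
    (∂_{v} φ) x = fderiv ℝ φ x v := by
  rw [TestFunction.lineDerivOp_eq_lineDerivCLM ℝ, TestFunction.lineDerivCLM_apply_of_le (by simp)]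
  exact ((φ.contDiff.differentiable (by simp)) x).lineDeriv_eq_fderiv

theorem clm_apply_eq_sum (L : Eucl n →L[ℝ] ℝ) (v : Eucl n) :
    L v = ∑ a, v a * L (basisVec a) := by
  conv_lhs => rw [← (EuclideanSpace.basisFun (Fin n) ℝ).sum_repr v]
  simp [map_sum]

theorem iteratedLineDeriv_rev_snoc {p : ℕ} (A : Fin p → Fin n) (a : Fin n)
    (φ : 𝓓((⊤ : Opens (Eucl n)), ℝ)) :
    ∂^{fun j : Fin (p + 1) => basisVec ((Fin.snoc A a : Fin (p + 1) → Fin n) j.rev)} φ =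
      ∂_{basisVec a} (∂^{fun j : Fin p => basisVec (A j.rev)} φ) := by
  rw [LineDeriv.iteratedLineDerivOp_succ_left]
  have h1 : Fin.tail (fun j : Fin (p + 1) =>
      (basisVec ((Fin.snoc A a : Fin (p + 1) → Fin n) j.rev) : Eucl n)) =
      fun j => basisVec (A j.rev) := by
    funext j
    simp [Fin.tail, Fin.rev_succ]
  rw [h1]
  simp

theorem hasDerivAt_test_line (φ : 𝓓((⊤ : Opens (Eucl n)), ℝ)) (y θ : Eucl n) (t : ℝ) :
    HasDerivAt (fun t : ℝ => φ (y + t • θ)) (∑ a, θ a * (∂_{basisVec a} φ) (y + t • θ)) t := by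
  have h1 : HasDerivAt (fun t : ℝ => y + t • θ) θ t := by
    simpa using ((hasDerivAt_id t).smul_const θ).const_add y
  refine (((φ.contDiff.differentiable (by simp)) (y + t • θ)).hasFDerivAt.comp_hasDerivAt t
    h1).congr_deriv ?_
  simp only [testFunction_lineDeriv_apply]
  exact clm_apply_eq_sum _ θ

/-- The derivatives of a test function along a line in terms of its partial derivatives. -/
theorem iteratedDeriv_test_line (φ : 𝓓((⊤ : Opens (Eucl n)), ℝ)) (y θ : Eucl n) (p : ℕ) :
    iteratedDeriv p (fun t : ℝ => φ (y + t • θ)) = fun t => ∑ A : Fin p → Fin n,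
      (∏ j, θ (A j)) * (∂^{fun j : Fin p => basisVec (A j.rev)} φ) (y + t • θ) := by
  induction p with
  | zero => funext t; simp
  | succ p ih =>
    funext t
    rw [iteratedDeriv_succ, ih, (HasDerivAt.fun_sum fun A _ =>
      (hasDerivAt_test_line _ y θ t).const_mul (∏ j, θ (A j))).deriv,
      ← (Fin.snocEquiv fun _ : Fin (p + 1) => Fin n).sum_comp, Fintype.sum_prod_type,
      Finset.sum_comm]
    refine Finset.sum_congr rfl fun A _ => ?_
    rw [Finset.mul_sum]
    refine Finset.sum_congr rfl fun a _ => ?_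
    simp only [Fin.snocEquiv, Equiv.coe_fn_mk, Fin.prod_univ_castSucc, Fin.snoc_castSucc,
      Fin.snoc_last, iteratedLineDeriv_rev_snoc]
    ring

theorem contractX_apply {a b : ℕ} (u : TensorField (Distr n) n (a + b)) (I : Fin a → Fin n)
    (φ : 𝓓((⊤ : Opens (Eucl n)), ℝ)) :
    contractX u I φ = ∑ Q : Fin b → Fin n, u (Fin.append I Q) (mulTest (monomialFun Q) φ) := by
  simp [contractX, smoothMul_apply]

theorem divPow_apply {a : ℕ} (p : ℕ) (u : TensorField (Distr n) n (a + p)) (I : Fin a → Fin n)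
    (φ : 𝓓((⊤ : Opens (Eucl n)), ℝ)) :
    TensorField.divPow p u I φ = ∑ A : Fin p → Fin n, u (Fin.append I A)
      ((-1 : ℝ) ^ p • ∂^{fun j : Fin p => basisVec (A j.rev)} φ) := by
  induction p with
  | zero =>
    have : ∀ A : Fin 0 → Fin n, Fin.append I A = I := fun A => by
      funext j; simp [Fin.append_right_nil]
    simp [TensorField.divPow, this]
  | succ p ih =>
    change TensorField.divPow p (TensorField.div u) I φ = _
    rw [ih, ← (Fin.snocEquiv fun _ : Fin (p + 1) => Fin n).sum_comp, Fintype.sum_prod_type,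
      Finset.sum_comm]
    refine Finset.sum_congr rfl fun A _ => ?_
    rw [TensorField.div, sum_apply]
    refine Finset.sum_congr rfl fun a _ => ?_
    rw [Distribution.lineDerivOp_apply_apply]
    congr 1
    · congr 1
      exact (Fin.append_snoc I A a).symm
    · simp only [Fin.snocEquiv, Equiv.coe_fn_mk, iteratedLineDeriv_rev_snoc]
      rw [LineDeriv.lineDerivOp_smul, pow_succ, mul_neg_one, neg_smul]

end Test

/-! ### The combination of the momentum operators that defines `G_{m-r}` -/

open scoped RealInnerProductSpace

section MomentSum

variable {n : ℕ}

theorem locallyIntegrable_of_abs_le (hn : 0 < n) {g : Eucl n → ℝ} (hg : Measurable g) {C α : ℝ}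
    (hα : α < n) (h : ∀ z : Eucl n, z ≠ 0 → |g z| ≤ C * ‖z‖ ^ (-α)) : LocallyIntegrable g := by
  have : Nonempty (Fin n) := ⟨⟨0, hn⟩⟩
  refine locallyIntegrable_of_norm_le_rpow (C := C) (α := α)
    (by rw [finrank_euclideanSpace, Fintype.card_fin]; exact hn) (by simpa using hα) ?_
    hg.aestronglyMeasurable
  filter_upwards [Measure.ae_ne volume (0 : Eucl n)] with z hz
  exact h z hz

/-- The kernel `z_{i_1} ⋯ z_{i_s} z_{j_1} ⋯ z_{j_m} / |z|^{2s + n - 1}`. -/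
def radialKernel {s m : ℕ} (I : Fin s → Fin n) (J : Fin m → Fin n) (z : Eucl n) : ℝ :=
  (∏ a, z (I a)) * (∏ a, z (J a)) / ‖z‖ ^ (2 * s + (n - 1))

theorem radialKernel_locallyIntegrable (hn : 0 < n) {s m : ℕ} (hs : s ≤ m) (I : Fin s → Fin n)
    (J : Fin m → Fin n) : LocallyIntegrable (radialKernel I J) := by
  refine locallyIntegrable_of_abs_le hn (C := 1)
    (α := ((2 * s + (n - 1) : ℕ) : ℝ) - ((s + m : ℕ) : ℝ))
    (by unfold radialKernel; fun_prop) ?_ fun z hz => ?_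
  · have h1 : 2 * s + (n - 1) < n + (s + m) := by omega
    have h2 : ((2 * s + (n - 1) : ℕ) : ℝ) < ((n + (s + m) : ℕ) : ℝ) := by exact_mod_cast h1
    rw [Nat.cast_add n] at h2
    linarith
  · have hz' : 0 < ‖z‖ := norm_pos_iff.2 hz
    rw [one_mul, neg_sub, Real.rpow_sub hz', Real.rpow_natCast, Real.rpow_natCast, radialKernel,
      abs_div, abs_pow, abs_norm, abs_mul, pow_add _ s m]
    gcongr
    · exact abs_prod_coord_le I z
    · exact abs_prod_coord_le J z

/-- The smooth function whose pairing with `f_J`, summed over `J`, is the pairing of `N_m^p f` with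
the test function `ψ`. -/
def normalTest {m : ℕ} (p : ℕ) (I J : Fin m → Fin n) (ψ : 𝓓((⊤ : Opens (Eucl n)), ℝ)) :
    SmoothFun n :=
  (2 : ℝ) • ∑ l ∈ Finset.range (p + 1), ((p.choose l : ℝ) * (-1) ^ l) •
    ∑ P : Fin (2 * p - l) → Fin n,
      corrFun (momentKernel_locallyIntegrable P I J) (mulTest (monomialFun P) ψ)

theorem normalOp_apply {m : ℕ} (p : ℕ) (f : TensorField (CompactDistr n) n m) (I : Fin m → Fin n)
    (ψ : 𝓓((⊤ : Opens (Eucl n)), ℝ)) : normalOp p f I ψ =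
      ∑ J : Fin m → Fin n, (f J : SmoothFun n →ₗ[ℝ] ℂ) (normalTest p I J ψ) := by
  simp only [normalOp, normalTest, map_smul, map_sum, ← Finset.smul_sum]
  rw [smul_apply, sum_apply]
  congr 1
  rw [Finset.sum_comm]
  refine Finset.sum_congr rfl fun l _ => ?_
  rw [← Finset.smul_sum, smul_apply, sum_apply]
  congr 1
  rw [Finset.sum_comm]
  refine Finset.sum_congr rfl fun P _ => ?_
  rw [smoothMul_apply, sum_apply]
  rfl

/-- The integrand of `normalTest` in terms of `z = x - y`. -/
def normalDensity {m : ℕ} (p : ℕ) (I J : Fin m → Fin n) (ψ : 𝓓((⊤ : Opens (Eucl n)), ℝ))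
    (y z : Eucl n) : ℝ :=
  2 * ∑ l ∈ Finset.range (p + 1), ((p.choose l : ℝ) * (-1) ^ l) *
    ∑ P : Fin (2 * p - l) → Fin n, momentKernel P I J z * mulTest (monomialFun P) ψ (y + z)

theorem integrable_normalDensity {m : ℕ} (p : ℕ) (I J : Fin m → Fin n)
    (ψ : 𝓓((⊤ : Opens (Eucl n)), ℝ)) (y : Eucl n) : Integrable (normalDensity p I J ψ y) :=
  (integrable_finsetSum _ fun _ _ => (integrable_finsetSum _ fun P _ =>
    integrable_mul_test (momentKernel_locallyIntegrable P I J) _ y).const_mul _).const_mul _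

theorem normalTest_coe {m : ℕ} (p : ℕ) (I J : Fin m → Fin n)
    (ψ : 𝓓((⊤ : Opens (Eucl n)), ℝ)) (y : Eucl n) :
    (normalTest p I J ψ : Eucl n → ℝ) y = ∫ z, normalDensity p I J ψ y z := by
  unfold normalDensity
  rw [integral_const_mul, integral_finsetSum _ fun _ _ => (integrable_finsetSum _ fun P _ =>
    integrable_mul_test (momentKernel_locallyIntegrable P I J) _ y).const_mul _]
  simp only [normalTest, Submodule.coe_smul, AddSubmonoidClass.coe_finsetSum, Pi.smul_apply,
    Finset.sum_apply, smul_eq_mul]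
  congr 1
  refine Finset.sum_congr rfl fun l _ => ?_
  rw [integral_const_mul, integral_finsetSum _ fun P _ =>
    integrable_mul_test (momentKernel_locallyIntegrable P I J) _ y]
  simp only [corrFun_apply]

theorem sum_prod_mul_prod (k : ℕ) (u v : Eucl n) :
    ∑ P : Fin k → Fin n, (∏ a, u (P a)) * ∏ a, v (P a) = ⟪u, v⟫ ^ k :=
  TensorField.contractAll_tpow k u v

theorem inner_line {θ : Eucl n} (hθ : ‖θ‖ = 1) (y : Eucl n) (t : ℝ) :
    ⟪θ, y + t • θ⟫ = ⟪θ, y⟫ + t := by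
  rw [inner_add_right, inner_smul_right, real_inner_self_eq_norm_sq, hθ]
  ring

theorem prod_smul_coord {k : ℕ} (t : ℝ) (θ : Eucl n) (I : Fin k → Fin n) :
    ∏ a, (t • θ) (I a) = t ^ k * ∏ a, θ (I a) := by
  simp [Finset.prod_mul_distrib]

/-- On the line `x = y + t θ` the kernel of the normal operator is, up to the weight `|t|^{n-1}`,
the product of the moments `(x · θ)^p` and `(y · θ)^p`. -/
theorem normalDensity_line {m : ℕ} (p : ℕ) (I J : Fin m → Fin n)
    (ψ : 𝓓((⊤ : Opens (Eucl n)), ℝ)) (y : Eucl n) {θ : Eucl n} (hθ : ‖θ‖ = 1) {t : ℝ}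
    (ht : t ≠ 0) : |t| ^ (n - 1) * normalDensity p I J ψ y (t • θ) =
      2 * ((∏ a, θ (I a)) * (∏ a, θ (J a))) *
        ((⟪θ, y⟫ + t) ^ p * ⟪θ, y⟫ ^ p * ψ (y + t • θ)) := by
  have ht' : |t| ≠ 0 := abs_ne_zero.2 ht
  set a := ⟪θ, y⟫ with ha
  have hl : ∀ l ∈ Finset.range (p + 1), |t| ^ (n - 1) * ∑ P : Fin (2 * p - l) → Fin n,
      momentKernel P I J (t • θ) * mulTest (monomialFun P) ψ (y + t • θ) =
      t ^ l * (a + t) ^ (p - l) * ((∏ a, θ (I a)) * (∏ a, θ (J a)) * (a + t) ^ p *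
        ψ (y + t • θ)) := by
    intro l hl
    have hlp : l ≤ p := Nat.lt_succ_iff.1 (Finset.mem_range.1 hl)
    have h1 : ∀ P : Fin (2 * p - l) → Fin n,
        |t| ^ (n - 1) * (momentKernel P I J (t • θ) * mulTest (monomialFun P) ψ (y + t • θ)) =
        t ^ l * ((∏ a, θ (I a)) * (∏ a, θ (J a)) * ψ (y + t • θ)) *
          ((∏ a, θ (P a)) * ∏ a, (y + t • θ) (P a)) := by
      intro P
      have he : |t| ^ (2 * m + 2 * (p - l) + (n - 1)) =
          t ^ (2 * m + 2 * (p - l)) * |t| ^ (n - 1) := by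
        rw [pow_add, show 2 * m + 2 * (p - l) = 2 * (m + (p - l)) by ring, pow_mul, pow_mul, sq_abs]
      have hp : t ^ (2 * p - l) * t ^ m * t ^ m = t ^ l * t ^ (2 * m + 2 * (p - l)) := by
        rw [← pow_add, ← pow_add, ← pow_add]
        congr 1
        omega
      rw [mulTest_apply, SmoothFun.monomialFun_apply, momentKernel, prod_smul_coord,
        prod_smul_coord, prod_smul_coord, norm_smul, hθ, mul_one, Real.norm_eq_abs, he]
      have h0 : t ^ (2 * m + 2 * (p - l)) ≠ 0 := pow_ne_zero _ ht
      have h0' : |t| ^ (n - 1) ≠ 0 := pow_ne_zero _ ht'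
      field_simp
      linear_combination ((∏ a, θ (P a)) * (∏ a, θ (I a)) * (∏ a, θ (J a)) *
        ψ (y + t • θ) * ∏ a, (y + t • θ) (P a)) * hp
    rw [Finset.mul_sum, Finset.sum_congr rfl fun P _ => h1 P, ← Finset.mul_sum, sum_prod_mul_prod,
      inner_line hθ, ← ha, show 2 * p - l = (p - l) + p by omega, pow_add]
    ring
  have hbin : ∑ l ∈ Finset.range (p + 1), ((p.choose l : ℝ) * (-1) ^ l) *
      (t ^ l * (a + t) ^ (p - l)) = a ^ p := by
    have h2 := add_pow (-t) (a + t) p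
    rw [show -t + (a + t) = a by ring] at h2
    rw [h2]
    refine Finset.sum_congr rfl fun l _ => ?_
    rw [neg_pow]
    ring
  have hsum : |t| ^ (n - 1) * normalDensity p I J ψ y (t • θ) =
      2 * ∑ l ∈ Finset.range (p + 1), ((p.choose l : ℝ) * (-1) ^ l) *
        (|t| ^ (n - 1) * ∑ P : Fin (2 * p - l) → Fin n,
          momentKernel P I J (t • θ) * mulTest (monomialFun P) ψ (y + t • θ)) := by
    rw [normalDensity, mul_left_comm, Finset.mul_sum]
    congr 1
    exact Finset.sum_congr rfl fun l _ => by ring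
  rw [hsum, Finset.sum_congr rfl fun l hl' => congrArg _ (hl l hl'), ← hbin, mul_assoc 2]
  simp only [Finset.sum_mul, Finset.mul_sum]
  refine Finset.sum_congr rfl fun l hl' => ?_
  ring

/-- The coefficients of `momentSum`. -/
def momentCoeff (r p : ℕ) : ℝ := (-1) ^ (r - p) * (p.factorial : ℝ)⁻¹ * (r.choose p : ℝ)

/-- The smooth function whose pairing with `f_J`, summed over `J`, is the pairing of `momentSum`
with the test function `φ`. -/
def momentTest {m : ℕ} (r : ℕ) (hr : r ≤ m) (I : Fin (m - r) → Fin n) (J : Fin m → Fin n)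
    (φ : 𝓓((⊤ : Opens (Eucl n)), ℝ)) : SmoothFun n :=
  ∑ p : Fin (r + 1), momentCoeff r p • ∑ Q : Fin (r - p) → Fin n, ∑ A : Fin p → Fin n,
    normalTest (p : ℕ) (Fin.append (Fin.append I Q) A ∘ Fin.cast (by omega)) J
      ((-1 : ℝ) ^ (p : ℕ) • ∂^{fun j : Fin p => basisVec (A j.rev)} (mulTest (monomialFun Q) φ))

theorem momentSum_apply {m : ℕ} (r : ℕ) (hr : r ≤ m) (f : TensorField (CompactDistr n) n m)
    (I : Fin (m - r) → Fin n) (φ : 𝓓((⊤ : Opens (Eucl n)), ℝ)) : momentSum r hr f I φ =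
      ∑ J : Fin m → Fin n, (f J : SmoothFun n →ₗ[ℝ] ℂ) (momentTest r hr I J φ) := by
  simp only [momentTest, map_smul, map_sum]
  rw [momentSum, Finset.sum_apply, sum_apply, Finset.sum_comm]
  refine Finset.sum_congr rfl fun p _ => ?_
  rw [Pi.smul_apply, smul_apply, contractX_apply, ← Finset.smul_sum]
  refine congrArg (momentCoeff r p • ·) ?_
  rw [Finset.sum_comm]
  refine Finset.sum_congr rfl fun Q _ => ?_
  rw [divPow_apply, Finset.sum_comm]
  refine Finset.sum_congr rfl fun A _ => ?_
  exact normalOp_apply _ _ _ _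

theorem prod_append_append_cast {a b c m : ℕ} (h : m = a + b + c) (z : Eucl n)
    (I : Fin a → Fin n) (Q : Fin b → Fin n) (A : Fin c → Fin n) :
    ∏ j, z ((Fin.append (Fin.append I Q) A ∘ Fin.cast h) j) =
      (∏ j, z (I j)) * (∏ j, z (Q j)) * ∏ j, z (A j) := by
  subst h
  simp [Fin.prod_univ_add]

theorem hasCompactSupport_test_line {φ : 𝓓((⊤ : Opens (Eucl n)), ℝ)} {y θ : Eucl n} (hθ : ‖θ‖ = 1) :
    HasCompactSupport fun t : ℝ => φ (y + t • θ) := by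
  refine φ.hasCompactSupport.comp_isClosedEmbedding (g := fun t : ℝ => y + t • θ) ?_
  refine Isometry.isClosedEmbedding (Isometry.of_dist_eq fun s t => ?_)
  rw [dist_add_left, dist_eq_norm, ← sub_smul, norm_smul, hθ, mul_one, Real.dist_eq,
    Real.norm_eq_abs]

/-- The sum over the contracted indices in `momentTest` is a derivative along the line. -/
theorem sum_prod_iteratedLineDeriv (φ : 𝓓((⊤ : Opens (Eucl n)), ℝ)) (y : Eucl n) {θ : Eucl n}
    (hθ : ‖θ‖ = 1) (p q : ℕ) (t : ℝ) :
    ∑ Q : Fin q → Fin n, ∑ A : Fin p → Fin n, (∏ j, θ (Q j)) * (∏ j, θ (A j)) *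
      (∂^{fun j : Fin p => basisVec (A j.rev)} (mulTest (monomialFun Q) φ)) (y + t • θ) =
      iteratedDeriv p (fun t : ℝ => (⟪θ, y⟫ + t) ^ q * φ (y + t • θ)) t := by
  set ψ : 𝓓((⊤ : Opens (Eucl n)), ℝ) :=
    ∑ Q : Fin q → Fin n, (∏ j, θ (Q j)) • mulTest (monomialFun Q) φ with hψ
  have h1 : (fun t : ℝ => (⟪θ, y⟫ + t) ^ q * φ (y + t • θ)) = fun t => ψ (y + t • θ) := by
    funext t
    rw [hψ, sum_apply, ← inner_line hθ, ← sum_prod_mul_prod, Finset.sum_mul]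
    refine Finset.sum_congr rfl fun Q _ => ?_
    rw [smul_apply, mulTest_apply, SmoothFun.monomialFun_apply, smul_eq_mul]
    ring
  rw [h1, iteratedDeriv_test_line, Finset.sum_comm]
  refine Finset.sum_congr rfl fun A _ => ?_
  rw [hψ, LineDeriv.iteratedLineDerivOp_sum, sum_apply, Finset.mul_sum]
  refine Finset.sum_congr rfl fun Q _ => ?_
  rw [LineDeriv.iteratedLineDerivOp_smul, smul_apply, smul_eq_mul]
  ring

/-- The integrand of `momentTest` in terms of `z = x - y`. -/
def momentDensity {m : ℕ} (r : ℕ) (hr : r ≤ m) (I : Fin (m - r) → Fin n) (J : Fin m → Fin n)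
    (φ : 𝓓((⊤ : Opens (Eucl n)), ℝ)) (y z : Eucl n) : ℝ :=
  ∑ p : Fin (r + 1), momentCoeff r p * ∑ Q : Fin (r - p) → Fin n, ∑ A : Fin p → Fin n,
    normalDensity (p : ℕ) (Fin.append (Fin.append I Q) A ∘ Fin.cast (by omega)) J
      ((-1 : ℝ) ^ (p : ℕ) • ∂^{fun j : Fin p => basisVec (A j.rev)} (mulTest (monomialFun Q) φ)) y z

theorem integrable_momentDensity {m : ℕ} (r : ℕ) (hr : r ≤ m) (I : Fin (m - r) → Fin n)
    (J : Fin m → Fin n) (φ : 𝓓((⊤ : Opens (Eucl n)), ℝ)) (y : Eucl n) :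
    Integrable (momentDensity r hr I J φ y) :=
  integrable_finsetSum _ fun _ _ => (integrable_finsetSum _ fun _ _ =>
    integrable_finsetSum _ fun _ _ => integrable_normalDensity _ _ _ _ _).const_mul _

theorem momentTest_coe {m : ℕ} (r : ℕ) (hr : r ≤ m) (I : Fin (m - r) → Fin n)
    (J : Fin m → Fin n) (φ : 𝓓((⊤ : Opens (Eucl n)), ℝ)) (y : Eucl n) :
    (momentTest r hr I J φ : Eucl n → ℝ) y = ∫ z, momentDensity r hr I J φ y z := by
  unfold momentDensity
  rw [integral_finsetSum _ fun _ _ => (integrable_finsetSum _ fun _ _ =>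
    integrable_finsetSum _ fun _ _ => integrable_normalDensity _ _ _ _ _).const_mul _]
  simp only [momentTest, Submodule.coe_smul, AddSubmonoidClass.coe_finsetSum, Pi.smul_apply,
    Finset.sum_apply, smul_eq_mul]
  refine Finset.sum_congr rfl fun p _ => ?_
  rw [integral_const_mul, integral_finsetSum _ fun _ _ =>
    integrable_finsetSum _ fun _ _ => integrable_normalDensity _ _ _ _ _]
  congr 1
  refine Finset.sum_congr rfl fun Q _ => ?_
  rw [integral_finsetSum _ fun _ _ => integrable_normalDensity _ _ _ _ _]
  exact Finset.sum_congr rfl fun A _ => normalTest_coe _ _ _ _ _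

theorem momentDensity_line {m : ℕ} (r : ℕ) (hr : r ≤ m) (I : Fin (m - r) → Fin n)
    (J : Fin m → Fin n) (φ : 𝓓((⊤ : Opens (Eucl n)), ℝ)) (y : Eucl n) {θ : Eucl n} (hθ : ‖θ‖ = 1)
    {t : ℝ} (ht : t ≠ 0) : |t| ^ (n - 1) * momentDensity r hr I J φ y (t • θ) =
      2 * ((∏ a, θ (I a)) * (∏ a, θ (J a))) * ∑ p : Fin (r + 1),
        momentCoeff r p * (-1) ^ (p : ℕ) * ⟪θ, y⟫ ^ (p : ℕ) * ((⟪θ, y⟫ + t) ^ (p : ℕ) *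
          iteratedDeriv p (fun t : ℝ => (⟪θ, y⟫ + t) ^ (r - p : ℕ) * φ (y + t • θ)) t) := by
  rw [momentDensity, Finset.mul_sum, Finset.mul_sum]
  refine Finset.sum_congr rfl fun p _ => ?_
  rw [← sum_prod_iteratedLineDeriv φ y hθ]
  simp only [Finset.mul_sum]
  refine Finset.sum_congr rfl fun Q _ => Finset.sum_congr rfl fun A _ => ?_
  rw [mul_left_comm, normalDensity_line _ _ _ _ _ hθ ht, prod_append_append_cast, smul_apply,
    smul_eq_mul]
  ring

theorem radialKernel_line {s r m : ℕ} (h : s + r = m) (I : Fin s → Fin n) (J : Fin m → Fin n)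
    {θ : Eucl n} (hθ : ‖θ‖ = 1) {t : ℝ} (ht : t ≠ 0) :
    |t| ^ (n - 1) * radialKernel I J (t • θ) =
      ((∏ a, θ (I a)) * (∏ a, θ (J a))) * t ^ r := by
  subst h
  have ht' : |t| ≠ 0 := abs_ne_zero.2 ht
  have h0 : |t| ^ (n - 1) ≠ 0 := pow_ne_zero _ ht'
  have h1 : t ^ (2 * s) ≠ 0 := pow_ne_zero _ ht
  have he : |t| ^ (2 * s + (n - 1)) = t ^ (2 * s) * |t| ^ (n - 1) := by
    rw [pow_add, pow_mul, pow_mul, sq_abs]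
  rw [radialKernel, prod_smul_coord, prod_smul_coord, norm_smul, hθ, mul_one, Real.norm_eq_abs, he]
  field_simp
  ring

/-- Integration by parts along all lines turns the combination of momentum operators into
convolution with a single translation invariant kernel, since
`∑_p (-1)^{r-p} C(r,p) (x · θ)^{r-p} (y · θ)^p = (-t)^r` for `x = y + t θ`. -/
theorem momentTest_eq (hn : 0 < n) {m : ℕ} (r : ℕ) (hr : r ≤ m) (I : Fin (m - r) → Fin n)
    (J : Fin m → Fin n) (φ : 𝓓((⊤ : Opens (Eucl n)), ℝ)) :
    momentTest r hr I J φ = (2 * (-1) ^ r : ℝ) •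
      corrFun (radialKernel_locallyIntegrable hn (Nat.sub_le m r) I J) φ := by
  refine Subtype.ext (funext fun y => ?_)
  rw [momentTest_coe, Submodule.coe_smul, Pi.smul_apply, smul_eq_mul, corrFun_apply,
    ← integral_const_mul, ← sub_eq_zero]
  have hR := (integrable_mul_test (radialKernel_locallyIntegrable hn (Nat.sub_le m r) I J)
    φ y).const_mul (2 * (-1) ^ r : ℝ)
  rw [← integral_sub (integrable_momentDensity r hr I J φ y) hR]
  set v : ℕ → Eucl n → ℝ → ℝ := fun q θ t => (⟪θ, y⟫ + t) ^ q * φ (y + t • θ) with hv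
  set G : Eucl n → ℝ → ℝ := fun θ t => 2 * ((∏ a, θ (I a)) * (∏ a, θ (J a))) *
    (∑ p : Fin (r + 1), momentCoeff r p * (-1) ^ (p : ℕ) * ⟪θ, y⟫ ^ (p : ℕ) *
      ((⟪θ, y⟫ + t) ^ (p : ℕ) * iteratedDeriv p (v (r - p) θ) t) -
        (-1) ^ r * (t ^ r * φ (y + t • θ))) with hG
  have hline : ∀ θ : Eucl n, ‖θ‖ = 1 → (fun t : ℝ => |t| ^ (n - 1) *
      (momentDensity r hr I J φ y (t • θ) -
        2 * (-1) ^ r * (radialKernel I J (t • θ) * φ (y + t • θ)))) =ᵐ[volume] G θ := by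
    intro θ hθ
    filter_upwards [Measure.ae_ne volume (0 : ℝ)] with t ht
    rw [mul_sub, momentDensity_line r hr I J φ y hθ ht, hG]
    simp only [mul_sub, hv]
    have := radialKernel_line (Nat.sub_add_cancel hr) I J hθ ht
    linear_combination (-2 * (-1) ^ r * φ (y + t • θ)) * this
  have hcd : ∀ q θ, ContDiff ℝ ∞ (v q θ) := fun q θ => by
    have h1 : ContDiff ℝ ∞ fun t : ℝ => φ (y + t • θ) :=
      φ.contDiff.comp (by fun_prop)
    exact ContDiff.mul (by fun_prop) h1
  have hcs : ∀ q θ, ‖θ‖ = 1 → HasCompactSupport (v q θ) := fun q θ hθ =>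
    (hasCompactSupport_test_line hθ).mul_left
  have hcsd : ∀ p q θ, ‖θ‖ = 1 → HasCompactSupport (iteratedDeriv p (v q θ)) := by
    intro p q θ hθ
    induction p with
    | zero => simpa using hcs q θ hθ
    | succ p ih => rw [iteratedDeriv_succ]; exact ih.deriv
  have hi1 : ∀ p q θ, ‖θ‖ = 1 →
      Integrable fun t : ℝ => (⟪θ, y⟫ + t) ^ p * iteratedDeriv p (v q θ) t := by
    intro p q θ hθ
    refine Continuous.integrable_of_hasCompactSupport (Continuous.mul (by fun_prop) ?_)
      (hcsd p q θ hθ).mul_left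
    exact (hcd q θ).continuous_iteratedDeriv p (by exact_mod_cast le_top)
  have hφc : ∀ θ : Eucl n, Continuous fun t : ℝ => φ (y + t • θ) := fun θ =>
    φ.continuous.comp (by fun_prop)
  have hi2 : ∀ θ : Eucl n, ‖θ‖ = 1 → Integrable fun t : ℝ => t ^ r * φ (y + t • θ) :=
    fun θ hθ => Continuous.integrable_of_hasCompactSupport (Continuous.mul (by fun_prop) (hφc θ))
      (hasCompactSupport_test_line hθ).mul_left
  have hi3 : ∀ θ : Eucl n, ‖θ‖ = 1 → ∀ p ∈ (Finset.univ : Finset (Fin (r + 1))),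
      Integrable fun t : ℝ => momentCoeff r p * (-1) ^ (p : ℕ) * ⟪θ, y⟫ ^ (p : ℕ) *
        ((⟪θ, y⟫ + t) ^ (p : ℕ) * iteratedDeriv p (v (r - p) θ) t) :=
    fun θ hθ p _ => (hi1 p _ θ hθ).const_mul _
  -- On each line it remains to integrate by parts `p` times in the `p`-th term.
  refine integral_eq_zero_of_forall_line hn ((integrable_momentDensity r hr I J φ y).sub hR)
    (fun θ hθ => Integrable.congr ?_ (hline θ hθ).symm) fun θ hθ => ?_
  · exact ((integrable_finsetSum _ (hi3 θ hθ)).sub ((hi2 θ hθ).const_mul _)).const_mul _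
  rw [integral_congr_ae (hline θ hθ), hG, integral_const_mul,
    integral_sub (integrable_finsetSum _ (hi3 θ hθ)) ((hi2 θ hθ).const_mul _),
    integral_finsetSum _ (hi3 θ hθ)]
  simp only [integral_const_mul]
  have hp : ∀ p : Fin (r + 1), momentCoeff r p * (-1) ^ (p : ℕ) * ⟪θ, y⟫ ^ (p : ℕ) *
      ∫ t, (⟪θ, y⟫ + t) ^ (p : ℕ) * iteratedDeriv p (v (r - p) θ) t =
      ∫ t, (r.choose p : ℝ) * ⟪θ, y⟫ ^ (p : ℕ) * (-1) ^ (r - p : ℕ) * v (r - p) θ t := by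
    intro p
    rw [integral_pow_mul_iteratedDeriv _ _ (hcd _ θ) (hcs _ θ hθ), integral_const_mul,
      momentCoeff]
    have h1 : ((p : ℕ).factorial : ℝ) ≠ 0 := by positivity
    have h2 : ((-1 : ℝ) ^ (p : ℕ)) * (-1) ^ (p : ℕ) = 1 := by rw [← mul_pow]; simp
    field_simp
    linear_combination ((r.choose p : ℝ) * ⟪θ, y⟫ ^ (p : ℕ) *
      ∫ t, v (r - p) θ t) * h2
  have hvi : ∀ q, Integrable (v q θ) := fun q =>
    (hcd q θ).continuous.integrable_of_hasCompactSupport (hcs q θ hθ)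
  rw [Finset.sum_congr rfl fun p _ => hp p, ← integral_finsetSum _ fun p _ =>
    (hvi _).const_mul _, ← integral_const_mul, ← integral_sub
      (integrable_finsetSum _ fun p _ => (hvi _).const_mul _) ((hi2 θ hθ).const_mul _)]
  have hz : ∀ t, ∑ p : Fin (r + 1), (r.choose p : ℝ) * ⟪θ, y⟫ ^ (p : ℕ) * (-1) ^ (r - p : ℕ) *
      v (r - p) θ t - (-1) ^ r * (t ^ r * φ (y + t • θ)) = 0 := by
    intro t
    have h1 := add_pow ⟪θ, y⟫ (-(⟪θ, y⟫ + t)) r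
    rw [show ⟪θ, y⟫ + -(⟪θ, y⟫ + t) = -t by ring, neg_pow] at h1
    rw [← mul_assoc, h1, Finset.sum_mul, ← Fin.sum_univ_eq_sum_range (fun p =>
      ⟪θ, y⟫ ^ p * (-(⟪θ, y⟫ + t)) ^ (r - p) * (r.choose p : ℝ) * φ (y + t • θ)), sub_eq_zero]
    refine Finset.sum_congr rfl fun p _ => ?_
    rw [hv, neg_pow (⟪θ, y⟫ + t)]
    ring
  simp only [hz, integral_zero, mul_zero]

/-- The sum defining `G_{m-r}` is a convolution with one translation invariant kernel, although the
operators `N_m^p` with `p ≥ 1` are not translation invariant. -/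
theorem momentSum_eq (hn : 0 < n) {m : ℕ} (r : ℕ) (hr : r ≤ m)
    (f : TensorField (CompactDistr n) n m) (I : Fin (m - r) → Fin n) :
    momentSum r hr f I = (2 * (-1) ^ r : ℝ) • ∑ J : Fin m → Fin n,
      conv (f J) (radialKernel_locallyIntegrable hn (Nat.sub_le m r) I J) := by
  ext φ
  rw [momentSum_apply, smul_apply, sum_apply, Finset.smul_sum]
  refine Finset.sum_congr rfl fun J _ => ?_
  rw [momentTest_eq hn, map_smul, conv_apply]

end MomentSum

/-! ### Convolution with a compactly supported distribution -/

section Conv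

variable {n : ℕ}

/-- A convolution does not see the value of the kernel at the origin, where the singular kernels
`z_I |z|^{-q}` have a junk value. -/
theorem conv_congr (T : CompactDistr n) {h h' : Eucl n → ℝ} (hh : LocallyIntegrable h)
    (hh' : LocallyIntegrable h') (heq : ∀ z, z ≠ 0 → h z = h' z) (hn : 0 < n) :
    conv T hh = conv T hh' := by
  have : Nonempty (Fin n) := ⟨⟨0, hn⟩⟩
  ext φ
  rw [conv_apply, conv_apply]
  congr 1
  refine Subtype.ext (funext fun y => ?_)
  rw [corrFun_apply, corrFun_apply]
  refine integral_congr_ae ?_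
  filter_upwards [Measure.ae_ne volume (0 : Eucl n)] with z hz
  rw [heq z hz]

theorem conv_add (T : CompactDistr n) {h h' : Eucl n → ℝ} (hh : LocallyIntegrable h)
    (hh' : LocallyIntegrable h') : conv T (hh.add hh') = conv T hh + conv T hh' := by
  ext φ
  rw [add_apply, conv_apply, conv_apply, conv_apply, ← map_add]
  congr 1
  refine Subtype.ext (funext fun y => ?_)
  simp only [Submodule.coe_add, Pi.add_apply, corrFun_apply, add_mul]
  exact integral_add (integrable_mul_test hh φ y) (integrable_mul_test hh' φ y)

theorem conv_smul (T : CompactDistr n) (c : ℝ) {h : Eucl n → ℝ} (hh : LocallyIntegrable h) :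
    conv T (hh.smul c) = c • conv T hh := by
  ext φ
  rw [smul_apply, conv_apply, conv_apply, ← map_smul]
  congr 1
  refine Subtype.ext (funext fun y => ?_)
  simp only [Submodule.coe_smul, Pi.smul_apply, corrFun_apply, smul_eq_mul, mul_assoc]
  exact integral_const_mul _ _

theorem conv_zero (T : CompactDistr n) : conv T (locallyIntegrable_zero (μ := volume)) = 0 := by
  ext φ
  rw [conv_apply, zero_apply, ← map_zero (T : SmoothFun n →ₗ[ℝ] ℂ)]
  congr 1
  refine Subtype.ext (funext fun y => ?_)
  simp [corrFun_apply]

theorem conv_add_left (S T : CompactDistr n) {h : Eucl n → ℝ} (hh : LocallyIntegrable h) :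
    conv (S + T) hh = conv S hh + conv T hh := rfl

theorem conv_smul_left (c : ℝ) (T : CompactDistr n) {h : Eucl n → ℝ} (hh : LocallyIntegrable h) :
    conv (c • T) hh = c • conv T hh := rfl

theorem dirDeriv_corrFun {h : Eucl n → ℝ} (hh : LocallyIntegrable h) (v : Eucl n)
    (φ : 𝓓((⊤ : Opens (Eucl n)), ℝ)) : dirDeriv v (corrFun hh φ) = corrFun hh (∂_{v} φ) := by
  refine Subtype.ext (funext fun y => ?_)
  have hh' := locallyIntegrable_neg_arg hh
  have h1 := φ.hasCompactSupport.hasFDerivAt_convolution_right (ContinuousLinearMap.lsmul ℝ ℝ) hh'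
    (φ.contDiff.of_le (by exact_mod_cast le_top)) y
  rw [SmoothFun.dirDeriv_apply, corrFun_coe, corrFun_coe, h1.fderiv, convolution_def,
    convolution_def]
  have h2 := (φ.hasCompactSupport.fderiv ℝ).convolutionExists_right
    ((ContinuousLinearMap.lsmul ℝ ℝ : ℝ →L[ℝ] ℝ →L[ℝ] ℝ).precompR (Eucl n)) hh'
    (φ.contDiff.continuous_fderiv (by simp)) y
  rw [ContinuousLinearMap.integral_apply h2]
  simp [testFunction_lineDeriv_apply]

theorem conv_lineDeriv_left (T : CompactDistr n) {h : Eucl n → ℝ} (hh : LocallyIntegrable h)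
    (v : Eucl n) : conv (∂_{v} T) hh = ∂_{v} (conv T hh) := by
  ext φ
  rw [Distribution.lineDerivOp_apply_apply, conv_apply, map_neg, conv_apply, ← dirDeriv_corrFun]
  rfl

theorem locallyIntegrable_coe (κ : SmoothFun n) :
    LocallyIntegrable (κ : Eucl n → ℝ) :=
  (contDiff_coe κ).continuous.locallyIntegrable

theorem conv_dirDeriv_apply (T : CompactDistr n) (κ : SmoothFun n) (v : Eucl n)
    (φ : 𝓓((⊤ : Opens (Eucl n)), ℝ)) :
    conv T (locallyIntegrable_coe (dirDeriv v κ)) φ =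
      conv T (locallyIntegrable_coe κ) (-∂_{v} φ) := by
  rw [conv_apply, conv_apply]
  congr 1
  refine Subtype.ext (funext fun y => ?_)
  rw [corrFun_apply, corrFun_apply]
  have hφ : Differentiable ℝ fun z => φ (y + z) :=
    (φ.contDiff.differentiable (by simp)).comp (by fun_prop)
  have hfd : ∀ z, fderiv ℝ (fun z => φ (y + z)) z v = (∂_{v} φ) (y + z) := fun z => by
    rw [testFunction_lineDeriv_apply, fderiv_comp_add_left]
  have h1 := integral_mul_fderiv_eq_neg_fderiv_mul_of_integrable (μ := (volume : Measure (Eucl n)))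
    (f := (κ : Eucl n → ℝ)) (g := fun z => φ (y + z)) (v := v)
    (integrable_mul_test (locallyIntegrable_coe (dirDeriv v κ)) φ y)
    (by simpa only [hfd] using integrable_mul_test (locallyIntegrable_coe κ) (∂_{v} φ) y)
    (integrable_mul_test (locallyIntegrable_coe κ) φ y) (fun x _ =>
      SmoothFun.differentiable_coe κ x) fun x _ => hφ x
  simp only [hfd] at h1
  simp only [neg_apply, mul_neg, integral_neg, h1, neg_neg]
  rfl

open scoped Pointwise in
/-- The convolution `T * κ` depends continuously on `κ ∈ L¹_loc`; the convergence in `L¹_loc` is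
obtained by dominated convergence. -/
theorem tendsto_conv (hn : 0 < n) (T : CompactDistr n) {κ : ℕ → Eucl n → ℝ} {κ₀ b : Eucl n → ℝ}
    (hκ : ∀ j, LocallyIntegrable (κ j)) (hκ₀ : LocallyIntegrable κ₀) (hb : LocallyIntegrable b)
    (hle : ∀ j z, z ≠ 0 → |κ j z| ≤ b z)
    (hlim : ∀ z, z ≠ 0 → Filter.Tendsto (fun j => κ j z) Filter.atTop (nhds (κ₀ z)))
    (φ : 𝓓((⊤ : Opens (Eucl n)), ℝ)) :
    Filter.Tendsto (fun j => conv T (hκ j) φ) Filter.atTop (nhds (conv T hκ₀ φ)) := by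
  have : Nonempty (Fin n) := ⟨⟨0, hn⟩⟩
  obtain ⟨K, N, C, hC, hT⟩ := T.2
  set L : Compacts (Eucl n) := ⟨tsupport φ, φ.hasCompactSupport⟩
  have hS : IsCompact ((K : Set (Eucl n)) - (L : Set (Eucl n))) := by
    rw [sub_eq_add_neg]; exact K.isCompact.add L.isCompact.neg
  set S := (K : Set (Eucl n)) - (L : Set (Eucl n))
  have hM : ∀ i, ∃ M, ∀ x, ‖iteratedFDeriv ℝ i φ x‖ ≤ M := fun i =>
    (φ.hasCompactSupport.iteratedFDeriv i).exists_bound_of_continuous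
      (φ.contDiff.continuous_iteratedFDeriv (by exact_mod_cast le_top))
  choose M hM using hM
  have hM0 : ∀ i, 0 ≤ M i := fun i => (norm_nonneg _).trans (hM i 0)
  have hd : ∀ j, LocallyIntegrable (κ j - κ₀) := fun j => (hκ j).sub hκ₀
  have hdiff : ∀ j, conv T (hκ j) φ - conv T hκ₀ φ = conv T (hd j) φ := by
    intro j
    rw [conv_apply, conv_apply, conv_apply, ← map_sub]
    congr 1
    refine Subtype.ext (funext fun y => ?_)
    simp only [AddSubgroupClass.coe_sub, Pi.sub_apply, corrFun_apply, sub_mul]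
    exact (integral_sub (integrable_mul_test (hκ j) φ y) (integrable_mul_test hκ₀ φ y)).symm
  have hbound : ∀ j, ‖conv T (hκ j) φ - conv T hκ₀ φ‖ ≤
      C * ((∫ t in S, ‖(κ j - κ₀) (-t)‖) * ∑ i ∈ Finset.range (N + 1), M i) := by
    intro j
    have hI : 0 ≤ ∫ t in S, ‖(κ j - κ₀) (-t)‖ := integral_nonneg fun _ => norm_nonneg _
    rw [hdiff, conv_apply]
    refine hT _ _ (mul_nonneg hI (Finset.sum_nonneg fun i _ => hM0 i)) fun i hi x hx => ?_
    rw [corrFun_coe]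
    refine (norm_iteratedFDeriv_convolution_le (locallyIntegrable_neg_arg (hd j)) L K i φ
      φ.contDiff subset_rfl (hM i) hx).trans ?_
    refine mul_le_mul_of_nonneg_left ?_ hI
    exact Finset.single_le_sum (f := M) (fun i _ => hM0 i)
      (Finset.mem_range.2 (Nat.lt_succ_of_le hi))
  have hint : Filter.Tendsto (fun j => ∫ t in S, ‖(κ j - κ₀) (-t)‖) Filter.atTop (nhds 0) := by
    have h0 : (0 : ℝ) = ∫ t in S, (0 : ℝ) := by simp
    rw [h0]
    have hne : ∀ᵐ t ∂(volume.restrict S), -t ≠ (0 : Eucl n) := by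
      filter_upwards [ae_restrict_of_ae (Measure.ae_ne volume (0 : Eucl n))] with t ht
      simpa using ht
    refine tendsto_integral_of_dominated_convergence (fun t => b (-t) + ‖κ₀ (-t)‖)
      (fun j => ((locallyIntegrable_neg_arg (hd j)).aestronglyMeasurable.norm).restrict) ?_
      (fun j => ?_) ?_
    · exact ((locallyIntegrable_neg_arg hb).integrableOn_isCompact hS).add
        ((locallyIntegrable_neg_arg hκ₀).integrableOn_isCompact hS).norm
    · filter_upwards [hne] with t ht
      rw [norm_norm, Pi.sub_apply]
      refine (norm_sub_le _ _).trans ?_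
      gcongr
      exact hle j _ ht
    · filter_upwards [hne] with t ht
      have h1 := ((hlim _ ht).sub_const (κ₀ (-t))).norm
      simpa using h1
  refine tendsto_iff_norm_sub_tendsto_zero.2 (squeeze_zero (fun _ => norm_nonneg _) hbound ?_)
  simpa using (hint.mul_const (∑ i ∈ Finset.range (N + 1), M i)).const_mul C

end Conv

/-! ### The fields `G_{m-r}` as convolutions -/

section FieldG

variable {n : ℕ}

/-- The right-hand side of `TensorField.partials_regPow`; for `ε = 0` and `z ≠ 0` it is
`∂_{I_1} ⋯ ∂_{I_s} |z|^{-(n-1)}`. -/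
def radialDeriv {s : ℕ} (ε : ℝ) (I : Fin s → Fin n) (z : Eucl n) : ℝ :=
  (-1) ^ s * ∑ l : Fin (s / 2 + 1), coeffC n l s *
    (TensorField.metricPart (l : ℕ) (by omega) z I *
      (‖z‖ ^ 2 + ε) ^ (-(((n : ℝ) - 1) / 2 + s - (l : ℕ))))

/-- The kernel `z_{j_1} ⋯ z_{j_m} ∂_{i_1} ⋯ ∂_{i_s} (|z|² + ε)^{-(n-1)/2}`. -/
def derivKernel {s m : ℕ} (ε : ℝ) (I : Fin s → Fin n) (J : Fin m → Fin n) (z : Eucl n) : ℝ :=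
  (∏ a, z (J a)) * radialDeriv ε I z

theorem measurable_derivKernel {s m : ℕ} (ε : ℝ) (I : Fin s → Fin n) (J : Fin m → Fin n) :
    Measurable (derivKernel ε I J) := by
  unfold derivKernel radialDeriv
  refine Measurable.mul (by fun_prop) (measurable_const.mul
    (Finset.measurable_fun_sum _ fun l _ => measurable_const.mul (Measurable.mul ?_ ?_)))
  · exact (TensorField.continuous_metricPart _ _ I).measurable
  · exact ((measurable_norm.pow_const 2).add_const ε).pow_const _

theorem regPow_rpow_le {ε β : ℝ} (hε : 0 ≤ ε) (hβ : 0 ≤ β) {z : Eucl n} (hz : z ≠ 0) :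
    (‖z‖ ^ 2 + ε) ^ (-β) ≤ ‖z‖ ^ (-(2 * β)) := by
  have hz' : 0 < ‖z‖ := norm_pos_iff.2 hz
  calc (‖z‖ ^ 2 + ε) ^ (-β) ≤ (‖z‖ ^ 2) ^ (-β) :=
        Real.rpow_le_rpow_of_nonpos (by positivity) (by linarith) (by linarith)
    _ = ‖z‖ ^ (-(2 * β)) := by
        rw [← Real.rpow_natCast, ← Real.rpow_mul hz'.le]
        congr 1
        push_cast
        ring

theorem abs_derivKernel_le (hn : 0 < n) {s m : ℕ} {ε : ℝ} (hε : 0 ≤ ε) (I : Fin s → Fin n)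
    (J : Fin m → Fin n) {z : Eucl n} (hz : z ≠ 0) : |derivKernel ε I J z| ≤
      (∑ l : Fin (s / 2 + 1), |coeffC n l s|) * ‖z‖ ^ (-((n : ℝ) - 1 + s - m)) := by
  have hz' : 0 < ‖z‖ := norm_pos_iff.2 hz
  have hn1 : (1 : ℝ) ≤ n := by exact_mod_cast hn
  have hsplit : ∀ l : Fin (s / 2 + 1), ‖z‖ ^ m * (‖z‖ ^ (s - 2 * l : ℕ) *
      ‖z‖ ^ (-(2 * (((n : ℝ) - 1) / 2 + s - (l : ℕ))))) = ‖z‖ ^ (-((n : ℝ) - 1 + s - m)) := by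
    intro l
    have hl : 2 * (l : ℕ) ≤ s := by omega
    rw [← Real.rpow_natCast, ← Real.rpow_natCast, ← Real.rpow_add hz', ← Real.rpow_add hz',
      Nat.cast_sub hl]
    congr 1
    push_cast
    ring
  rw [derivKernel, radialDeriv, abs_mul, abs_mul, abs_pow, abs_neg, abs_one, one_pow, one_mul]
  calc |∏ a, z (J a)| * |∑ l : Fin (s / 2 + 1), coeffC n l s *
        (TensorField.metricPart (l : ℕ) (by omega) z I *
          (‖z‖ ^ 2 + ε) ^ (-(((n : ℝ) - 1) / 2 + s - (l : ℕ))))|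
      ≤ ‖z‖ ^ m * ∑ l : Fin (s / 2 + 1), |coeffC n l s| * (‖z‖ ^ (s - 2 * l : ℕ) *
          ‖z‖ ^ (-(2 * (((n : ℝ) - 1) / 2 + s - (l : ℕ))))) := by
        refine mul_le_mul (abs_prod_coord_le J z) ?_ (abs_nonneg _) (by positivity)
        refine (Finset.abs_sum_le_sum_abs _ _).trans (Finset.sum_le_sum fun l _ => ?_)
        have hl : ((l : ℕ) : ℝ) ≤ s := by
          have : (l : ℕ) ≤ s := by omega
          exact_mod_cast this
        have hpos : (0 : ℝ) ≤ (‖z‖ ^ 2 + ε) ^ (-(((n : ℝ) - 1) / 2 + s - (l : ℕ))) := by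
          positivity
        rw [abs_mul, abs_mul, abs_of_nonneg hpos]
        refine mul_le_mul_of_nonneg_left ?_ (abs_nonneg _)
        exact mul_le_mul (TensorField.abs_metricPart_le _ _ z I)
          (regPow_rpow_le hε (by linarith) hz) hpos (by positivity)
    _ = _ := by
        rw [Finset.mul_sum, Finset.sum_mul]
        refine Finset.sum_congr rfl fun l _ => ?_
        rw [← hsplit l]
        ring

theorem locallyIntegrable_rpow_norm (hn : 0 < n) {s m : ℕ} (hs : s ≤ m) (C : ℝ) :
    LocallyIntegrable fun z : Eucl n => C * ‖z‖ ^ (-((n : ℝ) - 1 + s - m)) := by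
  refine locallyIntegrable_of_abs_le hn (C := |C|) (α := (n : ℝ) - 1 + s - m)
    ((measurable_norm.pow_const _).const_mul _) ?_ fun z _ => ?_
  · have : (s : ℝ) ≤ m := by exact_mod_cast hs
    linarith
  · rw [abs_mul, abs_of_nonneg (Real.rpow_nonneg (norm_nonneg z) _)]

theorem derivKernel_locallyIntegrable (hn : 0 < n) {s m : ℕ} (hs : s ≤ m) {ε : ℝ} (hε : 0 ≤ ε)
    (I : Fin s → Fin n) (J : Fin m → Fin n) : LocallyIntegrable (derivKernel ε I J) := by
  refine locallyIntegrable_of_abs_le hn (measurable_derivKernel ε I J)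
    (α := (n : ℝ) - 1 + s - m) ?_ fun z hz => abs_derivKernel_le hn hε I J hz
  have : (s : ℝ) ≤ m := by exact_mod_cast hs
  linarith

/-- `D` is the sum of the convolutions of the components of `f` with the kernels `κ_J`. -/
def IsConvSum {m : ℕ} (f : TensorField (CompactDistr n) n m) (κ : (Fin m → Fin n) → Eucl n → ℝ)
    (D : Distr n) : Prop :=
  ∃ hκ : ∀ J, LocallyIntegrable (κ J), D = ∑ J : Fin m → Fin n, conv (f J) (hκ J)

theorem isLinearRel_isConvSum {m : ℕ} (f : TensorField (CompactDistr n) n m) :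
    TensorField.IsLinearRel (IsConvSum f) where
  zero := ⟨fun _ => locallyIntegrable_zero,
    (Finset.sum_eq_zero fun _ _ => conv_zero _).symm⟩
  add := by
    rintro κ D κ' D' ⟨h, rfl⟩ ⟨h', rfl⟩
    refine ⟨fun J => (h J).add (h' J), ?_⟩
    rw [← Finset.sum_add_distrib]
    exact Finset.sum_congr rfl fun J _ => (conv_add _ _ _).symm
  smul := by
    rintro c κ D ⟨h, rfl⟩
    refine ⟨fun J => (h J).smul c, ?_⟩
    rw [Finset.smul_sum]
    exact Finset.sum_congr rfl fun J _ => (conv_smul _ _ _).symm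

theorem fieldG_isConvSum (hn : 0 < n) {m : ℕ} (r : ℕ) (hr : r ≤ m)
    (f : TensorField (CompactDistr n) n m) (I : Fin (m - r) → Fin n) :
    IsConvSum f (∑ l : Fin ((m - r) / 2 + 1), coeffC n l (m - r) •
      TensorField.mulContract (l : ℕ) (by omega)
        (fun I J => (2 * (-1) ^ r : ℝ) • radialKernel I J) I) (fieldG r hr f I) := by
  have h1 : ∀ I, IsConvSum f (fun J => (2 * (-1) ^ r : ℝ) • radialKernel I J)
      (momentSum r hr f I) := fun I => by
    rw [momentSum_eq hn]
    exact (isLinearRel_isConvSum f).smul (2 * (-1) ^ r)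
      ⟨fun J => radialKernel_locallyIntegrable hn (Nat.sub_le m r) I J, rfl⟩
  rw [fieldG, Finset.sum_apply]
  exact (isLinearRel_isConvSum f).sum _ fun l => (isLinearRel_isConvSum f).smul _
    ((isLinearRel_isConvSum f).mulContract _ _ h1 I)

/-- The sum over `l` with the constants `c_{l,s}` turns the kernels `z_I z_J |z|^{-(2s+n-1)}` into
`(-1)^s z_J ∂_I |z|^{-(n-1)}`. -/
theorem sum_mulContract_radialKernel {s m r : ℕ} (hn : 0 < n) (h : s + r = m) (I : Fin s → Fin n)
    (J : Fin m → Fin n) {z : Eucl n} (hz : z ≠ 0) :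
    (∑ l : Fin (s / 2 + 1), coeffC n l s •
      TensorField.mulContract (l : ℕ) (by omega)
        (fun I J => (2 * (-1) ^ r : ℝ) • radialKernel I J :
          TensorField ((Fin m → Fin n) → Eucl n → ℝ) n s) I) J z =
      ((2 * (-1) ^ m : ℝ) • derivKernel 0 I J) z := by
  have hz' : 0 < ‖z‖ := norm_pos_iff.2 hz
  set c : ℝ := 2 * (-1) ^ r * (∏ a, z (J a)) / ‖z‖ ^ (2 * s + (n - 1)) with hc
  have hrel : TensorField.IsLinearRel
      fun (κ : (Fin m → Fin n) → Eucl n → ℝ) (a : ℝ) => κ J z = c * a :=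
    ⟨by simp, fun h h' => by rw [Pi.add_apply, Pi.add_apply, h, h']; ring, fun d κ a h => by
      rw [Pi.smul_apply, Pi.smul_apply, h, smul_eq_mul, smul_eq_mul]; ring⟩
  have hl : ∀ l : Fin (s / 2 + 1), TensorField.mulContract (l : ℕ) (by omega)
      (fun I J => (2 * (-1) ^ r : ℝ) • radialKernel I J :
        TensorField ((Fin m → Fin n) → Eucl n → ℝ) n s) I J z =
      c * ((‖z‖ ^ 2) ^ (l : ℕ) * TensorField.metricPart (l : ℕ) (by omega) z I) := by
    intro l
    rw [← TensorField.mulContract_tpow]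
    refine hrel.mulContract _ _ (fun I => ?_) I
    rw [Pi.smul_apply, radialKernel, TensorField.tpow, hc, smul_eq_mul]
    ring
  have hsgn : (-1 : ℝ) ^ m * (-1) ^ s = (-1) ^ r := by
    rw [← h, pow_add, mul_right_comm, ← mul_pow]
    simp
  simp only [Finset.sum_apply, Pi.smul_apply, hl, smul_eq_mul, derivKernel, radialDeriv]
  rw [Finset.mul_sum, Finset.mul_sum, Finset.mul_sum]
  refine Finset.sum_congr rfl fun l _ => ?_
  have hp : (‖z‖ ^ 2 + 0) ^ (-(((n : ℝ) - 1) / 2 + s - (l : ℕ))) =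
      (‖z‖ ^ 2) ^ (l : ℕ) / ‖z‖ ^ (2 * s + (n - 1)) := by
    rw [add_zero, ← Real.rpow_natCast (‖z‖) 2, ← Real.rpow_mul hz'.le, ← Real.rpow_natCast,
      ← Real.rpow_natCast, ← Real.rpow_mul hz'.le, ← Real.rpow_sub hz']
    congr 1
    push_cast [Nat.cast_sub hn]
    ring
  rw [hp, hc]
  linear_combination (-(2 * (∏ a, z (J a)) / ‖z‖ ^ (2 * s + (n - 1)) * coeffC n l s *
    (‖z‖ ^ 2) ^ (l : ℕ) * TensorField.metricPart (l : ℕ) (by omega) z I)) * hsgn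

/-- `G_{m-r}` is, up to a constant, the convolution of `f` with `z^{⊗ m} ⊗ ∂^{m-r} |z|^{-(n-1)}`. -/
theorem fieldG_eq (hn : 0 < n) {m : ℕ} (r : ℕ) (hr : r ≤ m)
    (f : TensorField (CompactDistr n) n m) (I : Fin (m - r) → Fin n) :
    fieldG r hr f I = (2 * (-1) ^ m : ℝ) • ∑ J : Fin m → Fin n,
      conv (f J) (derivKernel_locallyIntegrable hn (Nat.sub_le m r) le_rfl I J) := by
  obtain ⟨h, heq⟩ := fieldG_isConvSum hn r hr f I
  rw [heq, Finset.smul_sum]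
  refine Finset.sum_congr rfl fun J _ => ?_
  rw [← conv_smul]
  exact conv_congr _ _ _ (fun z hz =>
    sum_mulContract_radialKernel hn (Nat.sub_add_cancel hr) I J hz) hn

theorem isSymm_fieldG (hn : 0 < n) {m : ℕ} (r : ℕ) (hr : r ≤ m)
    (f : TensorField (CompactDistr n) n m) : (fieldG r hr f).IsSymm := by
  intro π I
  rw [fieldG_eq hn, fieldG_eq hn]
  congr 1
  refine Finset.sum_congr rfl fun J _ => conv_congr _ _ _ (fun z _ => ?_) hn
  simp only [derivKernel, radialDeriv, TensorField.isSymm_metricPart _ _ z π I]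

end FieldG

/-! ### Removing the regularization -/

section Limit

variable {n : ℕ}

/-- The regularization `(|z|² + 1/(j+1))^{-(n-1)/2}` of `|z|^{-(n-1)}`. -/
def regSeq (n j : ℕ) : SmoothFun n :=
  SmoothFun.regPow n ((n : ℝ) - 1) (ε := 1 / ((j : ℝ) + 1)) (by positivity)

/-- The distributions `2 (-1)^m ∑_J f_J * P(D ⊗ 1, 1 ⊗ D)(z_J ⊗ h_j)`, with the regularizations
`h_j` of `|z|^{-(n-1)}`, converge to `D`. -/
def ConvergesTo {m : ℕ} (f : TensorField (CompactDistr n) n m) (P : Symb n) (D : Distr n) : Prop :=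
  ∀ φ : 𝓓((⊤ : Opens (Eucl n)), ℝ), Filter.Tendsto (fun j => (2 * (-1) ^ m : ℝ) •
    ∑ J : Fin m → Fin n, conv (f J)
      (locallyIntegrable_coe (SmoothFun.bidiffOp P (monomialFun J) (regSeq n j))) φ)
    Filter.atTop (nhds (D φ))

theorem conv_coe_add_apply (T : CompactDistr n) (κ κ' : SmoothFun n)
    (φ : 𝓓((⊤ : Opens (Eucl n)), ℝ)) : conv T (locallyIntegrable_coe (κ + κ')) φ =
      conv T (locallyIntegrable_coe κ) φ + conv T (locallyIntegrable_coe κ') φ := by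
  rw [← add_apply, ← conv_add]

theorem conv_coe_smul_apply (T : CompactDistr n) (c : ℝ) (κ : SmoothFun n)
    (φ : 𝓓((⊤ : Opens (Eucl n)), ℝ)) : conv T (locallyIntegrable_coe (c • κ)) φ =
      c • conv T (locallyIntegrable_coe κ) φ := by
  rw [← smul_apply, ← conv_smul]

theorem isLinearRel_convergesTo {m : ℕ} (f : TensorField (CompactDistr n) n m) :
    TensorField.IsLinearRel (ConvergesTo f) where
  zero := fun φ => by
    have h : ∀ (J : Fin m → Fin n) (j : ℕ), conv (f J)
        (locallyIntegrable_coe (SmoothFun.bidiffOp 0 (monomialFun J) (regSeq n j))) φ = 0 := by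
      intro J j
      rw [← zero_smul ℝ (0 : Symb n), SmoothFun.bidiffOp_smul, conv_coe_smul_apply, zero_smul]
    simp only [h, Finset.sum_const_zero, smul_zero, zero_apply]
    exact tendsto_const_nhds
  add := fun {P D P' D'} h h' φ => by
    simp only [SmoothFun.bidiffOp_add, conv_coe_add_apply, Finset.sum_add_distrib, smul_add,
      add_apply]
    exact (h φ).add (h' φ)
  smul := fun c {P D} h φ => by
    simp only [SmoothFun.bidiffOp_smul, conv_coe_smul_apply, ← Finset.smul_sum, smul_apply,
      smul_comm _ c]
    exact (h φ).const_smul c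

theorem ConvergesTo.lineDeriv {m : ℕ} {f : TensorField (CompactDistr n) n m} {P : Symb n}
    {D : Distr n} (h : ConvergesTo f P D) (a : Fin n) :
    ConvergesTo f (∂_{basisVec a} P) (∂_{basisVec a} D) := fun φ => by
  simp only [SmoothFun.bidiffOp_lineDeriv, conv_dirDeriv_apply,
    Distribution.lineDerivOp_apply_apply]
  exact h _

theorem ConvergesTo.unique {m : ℕ} {f : TensorField (CompactDistr n) n m} {P : Symb n}
    {D D' : Distr n} (h : ConvergesTo f P D) (h' : ConvergesTo f P D') : D = D' := by
  ext φ
  exact tendsto_nhds_unique (h φ) (h' φ)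

theorem tendsto_regRpow (β : ℝ) {z : Eucl n} (hz : z ≠ 0) :
    Filter.Tendsto (fun j : ℕ => (‖z‖ ^ 2 + 1 / ((j : ℝ) + 1)) ^ β) Filter.atTop
      (nhds ((‖z‖ ^ 2 + 0) ^ β)) := by
  have hz' : 0 < ‖z‖ := norm_pos_iff.2 hz
  exact (tendsto_one_div_add_atTop_nhds_zero_nat.const_add (‖z‖ ^ 2)).rpow_const
    (Or.inl (by positivity))

/-- The symbol of `∂_I` acting on `h` represents `G_{m-r}`. The dominating function is a multiple
of `|z|^{-(n-1-r)}`, which is locally integrable. -/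
theorem convergesTo_right (hn : 0 < n) {m : ℕ} (r : ℕ) (hr : r ≤ m)
    (f : TensorField (CompactDistr n) n m) (I : Fin (m - r) → Fin n) :
    ConvergesTo f (Symb.right I) (fieldG r hr f I) := fun φ => by
  have hs : m - r ≤ m := Nat.sub_le m r
  have hcoe : ∀ (J : Fin m → Fin n) (j : ℕ), (SmoothFun.bidiffOp (Symb.right I) (monomialFun J)
      (regSeq n j) : Eucl n → ℝ) = derivKernel (1 / ((j : ℝ) + 1)) I J := by
    intro J j
    funext z
    rw [SmoothFun.bidiffOp_right, SmoothFun.mul_apply, regSeq, TensorField.partials_regPow,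
      SmoothFun.monomialFun_apply]
    rfl
  rw [fieldG_eq hn, smul_apply, sum_apply]
  refine Filter.Tendsto.const_smul (tendsto_finsetSum _ fun J _ => ?_) _
  refine tendsto_conv hn (f J) _ _ (locallyIntegrable_rpow_norm hn hs
    (∑ l : Fin ((m - r) / 2 + 1), |coeffC n l (m - r)|)) (fun j z hz => ?_) (fun z hz => ?_) φ
  · rw [hcoe]
    exact abs_derivKernel_le hn (by positivity) I J hz
  · simp only [hcoe]
    exact (Filter.Tendsto.const_mul _ (tendsto_finsetSum _ fun l _ =>
      ((tendsto_regRpow _ hz).const_mul _).const_mul _)).const_mul _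

theorem normKernel_locallyIntegrable (hn : 0 < n) :
    LocallyIntegrable fun z : Eucl n => ‖z‖ ^ (-((n : ℝ) - 1)) := by
  simpa using locallyIntegrable_rpow_norm hn (le_refl 0) 1

theorem normalOpScalar_eq (hn : 0 < n) (T : CompactDistr n) :
    normalOpScalar T = (2 : ℝ) • conv T (normKernel_locallyIntegrable hn) := by
  have h1 : ∀ φ, normalOpScalar T φ = (2 : ℝ) • conv T (normKernel_locallyIntegrable hn) φ := by
    intro φ
    rw [normalOpScalar, normalOp_apply, conv_apply, ← map_smul]
    simp only [Finset.univ_unique, Finset.sum_singleton]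
    congr 1
    refine Subtype.ext (funext fun y => ?_)
    have : Nonempty (Fin n) := ⟨⟨0, hn⟩⟩
    rw [normalTest_coe, Submodule.coe_smul, Pi.smul_apply, corrFun_apply, smul_eq_mul,
      ← integral_const_mul]
    refine integral_congr_ae ?_
    filter_upwards [Measure.ae_ne volume (0 : Eucl n)] with z hz
    have hz' : 0 < ‖z‖ := norm_pos_iff.2 hz
    have hp : ‖z‖ ^ (-((n : ℝ) - 1)) = (‖z‖ ^ (n - 1))⁻¹ := by
      rw [Real.rpow_neg hz'.le, ← Real.rpow_natCast, Nat.cast_sub hn, Nat.cast_one]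
    rw [hp]
    simp [normalDensity, momentKernel, mulTest_apply, SmoothFun.monomialFun_apply]
  ext φ
  exact h1 φ

/-- The full derivatives of `z_J` are constant, so that the terms `f_J` add up to `m! f_I`. -/
theorem convergesTo_left (hn : 0 < n) {m : ℕ} {f : TensorField (CompactDistr n) n m}
    (hf : f.IsSymm) (I : Fin m → Fin n) :
    ConvergesTo f (Symb.left I) (((-1) ^ m * m.factorial : ℝ) • normalOpScalar (f I)) := fun φ => by
  set N : (Fin m → Fin n) → ℝ := fun J => ∑ π : Equiv.Perm (Fin m), if I ∘ π = J then 1 else 0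
    with hN
  have hcoe : ∀ (J : Fin m → Fin n) (j : ℕ), SmoothFun.bidiffOp (Symb.left I) (monomialFun J)
      (regSeq n j) = N J • regSeq n j := by
    intro J j
    refine Subtype.ext (funext fun z => ?_)
    rw [SmoothFun.bidiffOp_left, SmoothFun.mul_apply, SmoothFun.partials_monomialFun]
    rfl
  have hlim : ∀ J : Fin m → Fin n, Filter.Tendsto
      (fun j => conv (f J) (locallyIntegrable_coe (regSeq n j)) φ) Filter.atTop
      (nhds (conv (f J) (normKernel_locallyIntegrable hn) φ)) := by
    intro J
    have hn1 : (1 : ℝ) ≤ n := by exact_mod_cast hn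
    have h2 : ∀ z : Eucl n, z ≠ 0 →
        (‖z‖ ^ 2 + 0) ^ (-(((n : ℝ) - 1) / 2)) = ‖z‖ ^ (-((n : ℝ) - 1)) := fun z hz => by
      rw [add_zero, ← Real.rpow_natCast, ← Real.rpow_mul (norm_nonneg z)]
      congr 1
      push_cast
      ring
    refine tendsto_conv hn (f J) _ _ (normKernel_locallyIntegrable hn) (fun j z hz => ?_)
      (fun z hz => ?_) φ
    · have h1 := regPow_rpow_le (ε := 1 / ((j : ℝ) + 1)) (β := ((n : ℝ) - 1) / 2) (by positivity)
        (by linarith) hz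
      rw [regSeq, SmoothFun.regPow_apply, abs_of_nonneg (by positivity)]
      rwa [mul_div_cancel₀ _ two_ne_zero] at h1
    · rw [← h2 z hz]
      exact tendsto_regRpow _ hz
  have hsum : ((-1) ^ m * m.factorial : ℝ) • normalOpScalar (f I) φ = (2 * (-1) ^ m : ℝ) •
      ∑ J : Fin m → Fin n, N J • conv (f J) (normKernel_locallyIntegrable hn) φ := by
    have h3 : ∑ J : Fin m → Fin n, N J • conv (f J) (normKernel_locallyIntegrable hn) φ =
        (m.factorial : ℝ) • conv (f I) (normKernel_locallyIntegrable hn) φ := by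
      simp only [hN, Finset.sum_smul]
      rw [Finset.sum_comm]
      simp only [ite_smul, one_smul, zero_smul, Finset.sum_ite_eq, Finset.mem_univ, if_true, hf _ I,
        Finset.sum_const, Finset.card_univ, Fintype.card_perm, Fintype.card_fin]
      exact (Nat.cast_smul_eq_nsmul ℝ _ _).symm
    rw [h3, normalOpScalar_eq hn, smul_apply, smul_smul, smul_smul]
    congr 1
    ring
  rw [smul_apply, hsum]
  simp only [hcoe, conv_coe_smul_apply]
  exact (tendsto_finsetSum _ fun J _ => (hlim J).const_smul (N J)).const_smul _

theorem normalOpScalar_R (hn : 0 < n) (c : ℝ) {s : ℕ} (u : TensorField (CompactDistr n) n s)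
    (p q : Fin s → Fin n) : c • normalOpScalar (u.R p q) =
      TensorField.R (fun I => c • normalOpScalar (u I)) p q := by
  have hrel : TensorField.IsLinearRel
      fun (T : CompactDistr n) (D : Distr n) => c • normalOpScalar T = D :=
    ⟨by
        have h0 : conv (0 : CompactDistr n) (normKernel_locallyIntegrable hn) = 0 := rfl
        rw [normalOpScalar_eq hn, h0]
        ext φ
        rw [smul_apply, smul_apply, zero_apply, smul_zero, smul_zero],
      fun h h' => by
        rw [← h, ← h']
        simp only [normalOpScalar_eq hn, conv_add_left, smul_add],
      fun d T D h => by
        rw [← h]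
        simp only [normalOpScalar_eq hn, conv_smul_left, smul_comm d]⟩
  refine hrel.R (fun a T D h => ?_) (fun I => rfl) p q
  rw [← h]
  simp only [normalOpScalar_eq hn, conv_lineDeriv_left, LineDeriv.lineDerivOp_smul]

end Limit

end MomentumRay

end

theorem proposition4p3 {n : ℕ} (hn : 2 ≤ n) {m k : ℕ} (hk : k ≤ m)
    (f : MomentumRay.TensorField (MomentumRay.CompactDistr n) n m) (hf : f.IsSymm) :
    (∀ (r : ℕ) (hr : r ≤ k), (MomentumRay.fieldG r (hr.trans hk) f).IsSymm) ∧
    ∀ (p q : Fin (m - k) → Fin n) (i : Fin k → Fin n),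
      (m.factorial : ℝ) • MomentumRay.normalOpScalar
          ((MomentumRay.TensorField.fixIdx (Nat.sub_add_cancel hk) f i).R p q) =
        MomentumRay.TensorField.symm
          (fun i' : Fin k → Fin n => ∑ r : Fin (k + 1), ((-1) ^ (r : ℕ) * (k.choose r : ℝ)) •
            ∂^{fun a : Fin r => MomentumRay.basisVec (i' (Fin.castLE (by omega) a))}
              (MomentumRay.TensorField.Rgen (k := k - r) (by omega)
                (MomentumRay.fieldG (r : ℕ) (by omega) f) p q
                (fun a => i' (Fin.cast (by omega) (Fin.natAdd (r : ℕ) a))))) i := by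
  have hn0 : 0 < n := by omega
  refine ⟨fun r hr => MomentumRay.isSymm_fieldG hn0 r _ f, fun p q i => ?_⟩
  have hrel := MomentumRay.isLinearRel_convergesTo f
  -- Both sides are limits belonging to the symbol `(-1)^m R (∂_{p i} ⊗ 1)`.
  have hd : ∀ (a : Fin n) {P : MomentumRay.Symb n} {D : MomentumRay.Distr n},
      MomentumRay.ConvergesTo f P D → MomentumRay.ConvergesTo f (∂_{MomentumRay.basisVec a} P)
        (∂_{MomentumRay.basisVec a} D) := fun a _ _ h => h.lineDeriv a
  have hleft : MomentumRay.ConvergesTo f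
      ((-1 : ℝ) ^ m • (MomentumRay.TensorField.fixIdx (Nat.sub_add_cancel hk)
        MomentumRay.Symb.left i).R p q)
      ((m.factorial : ℝ) • MomentumRay.normalOpScalar
        ((MomentumRay.TensorField.fixIdx (Nat.sub_add_cancel hk) f i).R p q)) := by
    have h1 := hrel.smul ((-1 : ℝ) ^ m) (hrel.R hd
      (fun P => MomentumRay.convergesTo_left hn0 hf
        (Fin.append P i ∘ Fin.cast (Nat.sub_add_cancel hk).symm)) p q)
    have h2 := MomentumRay.normalOpScalar_R hn0 ((-1) ^ m * m.factorial : ℝ)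
      (MomentumRay.TensorField.fixIdx (Nat.sub_add_cancel hk) f i) p q
    have h3 : ((-1 : ℝ) ^ m) * ((-1) ^ m * m.factorial) = m.factorial := by
      rw [← mul_assoc, ← mul_pow]; simp
    rw [← h3, mul_smul, h2]
    exact h1
  rw [← MomentumRay.Symb.sum_symm_R_right hk p q i] at hleft
  refine hleft.unique (hrel.symm (fun i' => hrel.sum _ fun r => hrel.smul _
    (MomentumRay.TensorField.iteratedLineDeriv_rel hd _ (hrel.R hd (fun P => ?_) p q))) i)
  exact MomentumRay.convergesTo_right hn0 (r : ℕ) _ f _
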